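/- Let $X_1,X_2,\dots$ be i.i.d. real random variables that are $h$-lattice valued: for some $b\in\mathbf R$, $\sum_{k\in\mathbf Z}\mathbf P(X_i=kh+b)=1$, where $h>0$ is maximal among all steps for which such a $b$ exists. Assume $\mathbf E X_i=0$, $\mathbf E X_i^2=\sigma^2$ with $\sigma>0$, and $\mathbf E|X_i|^3<\infty$. Let $S_n=\sum_{i=1}^n X_i$, and for $c\in\mathbf R$ let "$S_n=c\sqrt n$" denote the event $S_n=\lfloor (c\sqrt n-nb)/h\rfloor\,h+nb$. Let $(n_i)_{i\ge1}$ be an increasing sequence of positive integers. (a) If $\sum_{i=1}^\infty n_i^{-1/2}<\infty$, then $\mathbf P(S_{n_i}=a\sqrt{n_i}\ \text{for infinitely many } i)=0$ for every $a\in\mathbf R$. (b) Suppose there are $A>0$ and $\gamma>1$ such that $n_{i+1}-n_i\ge A\,n_i^{1/2}$ for all $i\ge1$ and $$n_i\le A^{-1}\, i^2\,(\log i)\,(\log\log i)^{-3}\,(\log\log\log i)^{-2\gamma}\qquad\text{for all } i\ge 16.$$ Then for every $a\in\mathbf R$, almost surely, $$Q_n^a:=\frac{\sum_{i=1}^n 1_{\{S_{n_i}=a\sigma\sqrt{n_i}\}}}{\sum_{i=1}^n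 n_i^{-1/2}}\ \longrightarrow\ \ell_a:=\frac{h}{\sqrt{2\pi}\,\sigma}\,e^{-a^2/2}\qquad(n\to\infty).$$ Moreover, with $\Delta_n^a=Q_n^a/\ell_a$, for every $N>0$ there exists $C>0$ such that, for every $\epsilon>0$ and every integer $n\ge16$, $$\sup_{a\in[-N,N]}\mathbf P\bigl(|\Delta_n^a-1|>\epsilon\bigr)\le C\,\epsilon^{-2}\,(\log\log n)^{-1}\,(\log\log\log n)^{-\gamma}.$$ -/

import Mathlib

open MeasureTheory ProbabilityTheory Filter Topology

noncomputable section

/-- The random variable `Y` takes values in the lattice `b + h ℤ` almost surely. -/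
def SupportedOnLattice {Ω : Type*} [MeasurableSpace Ω] (P : Measure Ω) (Y : Ω → ℝ)
    (h b : ℝ) : Prop :=
  ∀ᵐ ω ∂P, ∃ k : ℤ, Y ω = k * h + b

/-- `Y` is `h`-lattice valued, with offset `b`: almost surely `Y ∈ b + h ℤ`, where `h > 0` is
maximal among all steps (over all offsets) with this property. -/
structure IsLatticeValued {Ω : Type*} [MeasurableSpace Ω] (P : Measure Ω) (Y : Ω → ℝ)
    (h b : ℝ) : Prop where
  pos : 0 < h
  supported : SupportedOnLattice P Y h b
  maximal : ∀ h' b' : ℝ, 0 < h' → SupportedOnLattice P Y h' b' → h' ≤ h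

/-- The partial sum of the first `n` variables of the sequence `X 0, X 1, X 2, …`. -/
def partialSum {Ω : Type*} (X : ℕ → Ω → ℝ) (n : ℕ) (ω : Ω) : ℝ :=
  ∑ i ∈ Finset.range n, X i ω

/-- The point `⌊(x - n b) / h⌋ h + n b` of the lattice `n b + h ℤ` (the largest one that is at
most `x`, for `h > 0`). -/
def latticePoint (h b : ℝ) (n : ℕ) (x : ℝ) : ℝ :=
  (⌊(x - n * b) / h⌋ : ℝ) * h + n * b

/-- The event written "`S_n = c √n`", that is, `S_n = ⌊(c √n - n b) / h⌋ h + n b`. -/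
def hitEvent {Ω : Type*} (X : ℕ → Ω → ℝ) (h b c : ℝ) (n : ℕ) : Set Ω :=
  {ω | partialSum X n ω = latticePoint h b n (c * √(n : ℝ))}

/-- The quotient of `∑_{i = 1}^m 1_{S_{n_i} = a σ √n_i}` by `∑_{i = 1}^m n_i^{-1/2}`. -/
def hitQuotient {Ω : Type*} (X : ℕ → Ω → ℝ) (h b σ : ℝ) (n : ℕ → ℕ) (a : ℝ) (m : ℕ)
    (ω : Ω) : ℝ :=
  (∑ i ∈ Finset.Icc 1 m, (hitEvent X h b (a * σ) (n i)).indicator (fun _ => (1 : ℝ)) ω) /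
    ∑ i ∈ Finset.Icc 1 m, (n i : ℝ) ^ (-(1 / 2) : ℝ)

/-- The almost sure limit `h (√(2π) σ)⁻¹ exp (-a² / 2)`. -/
def hitLimit (h σ a : ℝ) : ℝ :=
  h / (√(2 * Real.pi) * σ) * Real.exp (-a ^ 2 / 2)

end

/-! Everything rests on a local limit theorem with error `C / n` (`exists_local_limit`). By Fourier
inversion over one period, the probability of a lattice point is an integral of a power of the
characteristic function. The third moment controls that function near zero, and maximality of the
step keeps its modulus below one on the rest of the period. Hitting probabilities are therefore `O(1
/ √n)`, and (a) is the first Borel–Cantelli lemma.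

For (b), put M_m = ∑_{i ≤ m} n_i^{-1/2} and centre each hitting indicator at ℓ_a / √n. Independence
of increments turns a joint hit at times m < n into a product, and the local limit theorem bounds
the mixed moment of the centred indicators from above by a constant times 1/(√n √(n-m)) + a²/n +
1/(√m (n-m)) (`HasLocalLimit.exists_integral_centredHit_mul_le`). The gap condition makes √n_i grow
at least linearly, so for fixed j these bounds sum over i < j to O(1/√n_j) (`sum_offDiagonal_le`).
The second moment of the centred hit count is then O(M_m), no larger in order than the diagonal
alone (`HasLocalLimit.exists_integral_sq_sum_centredHit_le`), and Chebyshev gives P(|Q_m - ℓ_a| > δ)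
= O(1 / (δ² M_m)).

Almost sure convergence follows along indices where M is about k², whose tails are summable, and
extends to all indices by monotonicity (`ae_tendsto_div_of_measure_le`). The rate follows because
the growth condition forces M_m ≥ c √(log m) (`exists_mul_sqrt_log_le_sum`), which dominates log log
m · (log log log m)^γ. -/

/-! ### Characteristic function estimates. -/

/-- Third order Taylor bound for the imaginary exponential. -/
theorem norm_cexp_mul_I_sub_taylor_le (x : ℝ) :
    ‖Complex.exp (x * Complex.I) - (1 + x * Complex.I - (x : ℂ) ^ 2 / 2)‖ ≤ 4 * |x| ^ 3 := by
  have hn : ‖(x : ℂ) * Complex.I‖ = |x| := by simp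
  rcases le_or_gt |x| 1 with hx | hx
  · have h := Complex.exp_bound (x := (x : ℂ) * Complex.I) (by rw [hn]; exact hx)
      (n := 3) (by norm_num)
    rw [hn] at h
    have he : ∑ m ∈ Finset.range 3, ((x : ℂ) * Complex.I) ^ m / (m.factorial : ℂ)
        = 1 + x * Complex.I - (x : ℂ) ^ 2 / 2 := by
      simp [Finset.sum_range_succ, mul_pow, Nat.factorial]
      ring
    rw [he] at h
    refine h.trans ?_
    rw [mul_comm]
    refine mul_le_mul_of_nonneg_right ?_ (by positivity)
    norm_num [Nat.factorial]
  · have h1 : ‖Complex.exp (x * Complex.I) - (1 + x * Complex.I - (x : ℂ) ^ 2 / 2)‖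
        ≤ 1 + (1 + |x| + |x| ^ 2 / 2) := by
      refine (norm_sub_le _ _).trans ?_
      rw [Complex.norm_exp_ofReal_mul_I]
      gcongr
      refine (norm_sub_le _ _).trans ?_
      refine add_le_add ((norm_add_le _ _).trans ?_) ?_
      · simp
      · simp
    have h2 : 1 ≤ |x| ^ 2 := one_le_pow₀ hx.le
    nlinarith

/-- A third moment controls the second order expansion of the characteristic function. -/
theorem norm_charFun_sub_taylor_le {μ : Measure ℝ} [IsProbabilityMeasure μ] {σ : ℝ}
    (h3 : Integrable (fun x => |x| ^ 3) μ) (h1 : ∫ x, x ∂μ = 0) (h2 : ∫ x, x ^ 2 ∂μ = σ ^ 2)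
    (t : ℝ) :
    ‖charFun μ t - ((1 - σ ^ 2 * t ^ 2 / 2 : ℝ) : ℂ)‖ ≤ 4 * (∫ x, |x| ^ 3 ∂μ) * |t| ^ 3 := by
  have hle : ∀ x : ℝ, |x| ≤ 1 + |x| ^ 3 ∧ x ^ 2 ≤ 1 + |x| ^ 3 := by
    intro x
    have h0 := abs_nonneg x
    rw [← sq_abs x]
    constructor
    · nlinarith [sq_nonneg (|x| - 1), mul_nonneg h0 (sq_nonneg (|x| - 1))]
    · nlinarith [sq_nonneg (|x| - 1), mul_nonneg h0 (sq_nonneg (|x| - 1))]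
  have hi1 : Integrable (fun x : ℝ => x) μ :=
    ((integrable_const (1 : ℝ)).add h3).mono' (by fun_prop) (ae_of_all _ fun x => (hle x).1)
  have hi2 : Integrable (fun x : ℝ => x ^ 2) μ :=
    ((integrable_const (1 : ℝ)).add h3).mono' (by fun_prop)
      (ae_of_all _ fun x => by simpa using (hle x).2)
  have hie : Integrable (fun x : ℝ => Complex.exp (t * x * Complex.I)) μ := by
    refine (integrable_const (1 : ℝ)).mono' (by fun_prop) (ae_of_all _ fun x => ?_)
    rw [← Complex.ofReal_mul, Complex.norm_exp_ofReal_mul_I]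
  have hit : Integrable
      (fun x : ℝ => ((1 : ℂ) + t * x * Complex.I - (t * x : ℂ) ^ 2 / 2)) μ := by
    refine ((integrable_const (1 : ℂ)).add ?_).sub ?_
    · exact ((hi1.ofReal (𝕜 := ℂ)).const_mul (t : ℂ)).mul_const Complex.I
    · refine ((hi2.ofReal (𝕜 := ℂ)).const_mul ((t : ℂ) ^ 2 / 2)).congr (ae_of_all _ fun x => ?_)
      change (t : ℂ) ^ 2 / 2 * ((x ^ 2 : ℝ) : ℂ) = _
      push_cast; ring
  have hint : ∫ x : ℝ, ((1 : ℂ) + t * x * Complex.I - (t * x : ℂ) ^ 2 / 2) ∂μ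
      = ((1 - σ ^ 2 * t ^ 2 / 2 : ℝ) : ℂ) := by
    have e : ∀ x : ℝ, ((1 : ℂ) + t * x * Complex.I - (t * x : ℂ) ^ 2 / 2)
        = ((1 - t ^ 2 / 2 * x ^ 2 : ℝ) : ℂ) + ((t * x : ℝ) : ℂ) * Complex.I := by
      intro x; push_cast; ring
    simp_rw [e]
    rw [integral_add, integral_mul_const, integral_complex_ofReal, integral_complex_ofReal,
      integral_sub,
      integral_const_mul, integral_const_mul, h1, h2]
    · simp; ring
    · exact integrable_const _
    · exact hi2.const_mul _
    · exact (((integrable_const (1 : ℝ)).sub (hi2.const_mul (t ^ 2 / 2)))).ofReal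
    · exact ((hi1.const_mul t).ofReal (𝕜 := ℂ)).mul_const _
  rw [charFun_apply_real, ← hint, ← integral_sub hie hit]
  refine (norm_integral_le_of_norm_le (h3.const_mul (4 * |t| ^ 3))
    (ae_of_all _ fun x => ?_)).trans ?_
  · have := norm_cexp_mul_I_sub_taylor_le (t * x)
    rw [abs_mul, mul_pow] at this
    push_cast at this
    linarith
  · rw [integral_const_mul]
    linarith

/-- If the characteristic function has modulus one at `t ≠ 0`, then the measure lives on a
lattice of step `2π / t`. -/
theorem ae_mem_lattice_of_norm_charFun_eq_one {μ : Measure ℝ} [IsProbabilityMeasure μ] {t : ℝ}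
    (ht : t ≠ 0) (h : ‖charFun μ t‖ = 1) :
    ∃ d : ℝ, ∀ᵐ x ∂μ, ∃ k : ℤ, x = k * (2 * Real.pi / t) + d := by
  set u := charFun μ t with hu
  have hie : Integrable (fun x : ℝ => Complex.exp (t * x * Complex.I)) μ := by
    refine (integrable_const (1 : ℝ)).mono' (by fun_prop) (ae_of_all _ fun x => ?_)
    rw [← Complex.ofReal_mul, Complex.norm_exp_ofReal_mul_I]
  have hie' := hie.const_mul (starRingEnd ℂ u)
  have huu : (starRingEnd ℂ) u * u = 1 := by
    rw [mul_comm, Complex.mul_conj, Complex.normSq_eq_norm_sq, h]; simp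
  have hI : ∫ x : ℝ, ((starRingEnd ℂ) u * Complex.exp (t * x * Complex.I)).re ∂μ = 1 := by
    refine (integral_re hie').trans ?_
    rw [integral_const_mul, ← charFun_apply_real, ← hu, huu]
    simp
  have hre : Integrable
      (fun x : ℝ => ((starRingEnd ℂ) u * Complex.exp (t * x * Complex.I)).re) μ := hie'.re
  have hn : ∀ x : ℝ, ‖(starRingEnd ℂ) u * Complex.exp (t * x * Complex.I)‖ = 1 := by
    intro x
    rw [norm_mul, ← Complex.ofReal_mul, Complex.norm_exp_ofReal_mul_I, RCLike.norm_conj, h,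
      one_mul]
  -- The equality case of the triangle inequality: a nonnegative function with zero integral
  -- vanishes almost everywhere, and a complex number of modulus one with real part one equals one.
  have h0 : ∫ x : ℝ, (1 - ((starRingEnd ℂ) u * Complex.exp (t * x * Complex.I)).re) ∂μ = 0 := by
    rw [integral_sub (integrable_const _) hre, hI]; simp
  rw [integral_eq_zero_iff_of_nonneg] at h0
  · refine ⟨u.arg / t, ?_⟩
    filter_upwards [h0] with x hx
    simp only [Pi.zero_apply, sub_eq_zero] at hx
    have h1 : (starRingEnd ℂ) u * Complex.exp (t * x * Complex.I) = 1 := by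
      have hx1 := hx.symm
      have hnn := hn x
      set z := (starRingEnd ℂ) u * Complex.exp (t * x * Complex.I)
      have hs : z.re ^ 2 + z.im ^ 2 = 1 := by
        have := Complex.sq_norm z
        rw [hnn, Complex.normSq_apply] at this
        nlinarith
      refine Complex.ext hx1 ?_
      rw [hx1] at hs
      have : z.im ^ 2 = 0 := by linarith
      simpa using this
    have h2 : Complex.exp (t * x * Complex.I) = Complex.exp (u.arg * Complex.I) := by
      have e : Complex.exp (u.arg * Complex.I) = u := by
        have := Complex.norm_mul_exp_arg_mul_I u
        rw [h] at this
        simpa using this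
      rw [e]
      calc Complex.exp (t * x * Complex.I)
          = ((starRingEnd ℂ) u * u) * Complex.exp (t * x * Complex.I) := by rw [huu, one_mul]
        _ = u * ((starRingEnd ℂ) u * Complex.exp (t * x * Complex.I)) := by ring
        _ = u := by rw [h1, mul_one]
    obtain ⟨k, hk⟩ := Complex.exp_eq_exp_iff_exists_int.1 h2
    refine ⟨k, ?_⟩
    have h3 : ((t * x : ℝ) : ℂ) = ((u.arg + k * (2 * Real.pi) : ℝ) : ℂ) := by
      apply mul_right_cancel₀ Complex.I_ne_zero
      push_cast
      rw [hk]; ring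
    have h4 := Complex.ofReal_injective h3
    field_simp
    linarith
  · intro x
    have := Complex.re_le_norm ((starRingEnd ℂ) u * Complex.exp (t * x * Complex.I))
    rw [hn x] at this
    simpa using this
  · exact (integrable_const _).sub hre

/-- Gaussian bound for the modulus of the characteristic function on a bounded interval. -/
theorem exists_norm_charFun_le_exp {μ : Measure ℝ} [IsProbabilityMeasure μ] {σ R : ℝ}
    (h3 : Integrable (fun x => |x| ^ 3) μ) (h1 : ∫ x, x ∂μ = 0) (h2 : ∫ x, x ^ 2 ∂μ = σ ^ 2)
    (hσ : 0 < σ) (hR : 0 < R) (hlt : ∀ t, t ≠ 0 → |t| ≤ R → ‖charFun μ t‖ < 1) :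
    ∃ c, 0 < c ∧ c ≤ σ ^ 2 / 4 ∧ ∀ t, |t| ≤ R → ‖charFun μ t‖ ≤ Real.exp (-(c * t ^ 2)) := by
  set M := ∫ x, |x| ^ 3 ∂μ with hM
  have hM0 : 0 ≤ M := integral_nonneg fun x => by positivity
  -- The first bound keeps the Taylor main term 1 - σ²t²/2 nonnegative; the second lets the cubic
  -- error consume at most half of the quadratic decrease.
  set δ := min (1 / σ) (σ ^ 2 / (16 * (M + 1))) with hδ
  have hδ0 : 0 < δ := by positivity
  have hδ1 : δ * σ ≤ 1 := by
    have := min_le_left (1 / σ) (σ ^ 2 / (16 * (M + 1)))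
    rw [← hδ, le_div_iff₀ hσ] at this
    exact this
  have hδ2 : δ * (16 * (M + 1)) ≤ σ ^ 2 := by
    have := min_le_right (1 / σ) (σ ^ 2 / (16 * (M + 1)))
    rwa [← hδ, le_div_iff₀ (by positivity)] at this
  have hnear : ∀ t, |t| ≤ δ → ‖charFun μ t‖ ≤ Real.exp (-(σ ^ 2 / 4 * t ^ 2)) := by
    intro t ht
    have hT := norm_charFun_sub_taylor_le h3 h1 h2 t
    have h0 := abs_nonneg t
    have hst : σ ^ 2 * t ^ 2 ≤ 1 := by
      rw [← sq_abs t, ← mul_pow]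
      refine pow_le_one₀ (by positivity) ?_
      calc σ * |t| ≤ σ * δ := by gcongr
        _ ≤ 1 := by linarith
    have hn : ‖((1 - σ ^ 2 * t ^ 2 / 2 : ℝ) : ℂ)‖ = 1 - σ ^ 2 * t ^ 2 / 2 := by
      rw [Complex.norm_real, Real.norm_of_nonneg]; linarith
    have hle : ‖charFun μ t‖ ≤ (1 - σ ^ 2 * t ^ 2 / 2) + 4 * M * |t| ^ 3 := by
      rw [← hn]
      exact (norm_le_norm_add_norm_sub' _ _).trans (add_le_add le_rfl hT)
    have hcub : 4 * M * |t| ^ 3 ≤ σ ^ 2 / 4 * t ^ 2 := by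
      rw [← sq_abs t]
      have : 4 * M * |t| ≤ σ ^ 2 / 4 := by nlinarith
      nlinarith [sq_nonneg |t|]
    have := Real.add_one_le_exp (-(σ ^ 2 / 4 * t ^ 2))
    linarith
  -- Away from zero, compactness gives a uniform bound ρ < 1. It becomes Gaussian with the constant
  -- (1 - ρ) / R², since then exp(-c t²) ≥ 1 - c t² ≥ ρ.
  obtain ⟨ρ, hρ1, hρ⟩ : ∃ ρ < 1, ∀ t, δ ≤ |t| → |t| ≤ R → ‖charFun μ t‖ ≤ ρ := by
    have hcpt : IsCompact {t : ℝ | δ ≤ |t| ∧ |t| ≤ R} := by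
      refine (isCompact_Icc (a := -R) (b := R)).of_isClosed_subset ?_ ?_
      · exact (isClosed_le continuous_const continuous_abs).inter
          (isClosed_le continuous_abs continuous_const)
      · intro t ht
        exact abs_le.1 ht.2
    rcases Set.eq_empty_or_nonempty {t : ℝ | δ ≤ |t| ∧ |t| ≤ R} with he | hne
    · refine ⟨0, by norm_num, fun t ha hb => ?_⟩
      have : t ∈ {t : ℝ | δ ≤ |t| ∧ |t| ≤ R} := ⟨ha, hb⟩
      rw [he] at this
      exact this.elim
    · obtain ⟨t₀, ht₀, hmax⟩ := hcpt.exists_isMaxOn hne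
        (f := fun t => ‖charFun μ t‖) (by
          have := continuous_charFun (μ := μ)
          fun_prop)
      refine ⟨‖charFun μ t₀‖, hlt t₀ ?_ ht₀.2, fun t ha hb => hmax ⟨ha, hb⟩⟩
      rintro rfl
      have := ht₀.1
      simp at this
      linarith
  refine ⟨min (σ ^ 2 / 4) ((1 - ρ) / R ^ 2), ?_, min_le_left _ _, fun t ht => ?_⟩
  · have : 0 < 1 - ρ := by linarith
    positivity
  · rcases le_or_gt |t| δ with h | h
    · refine (hnear t h).trans (Real.exp_le_exp.2 ?_)
      have := mul_le_mul_of_nonneg_right (min_le_left (σ ^ 2 / 4) ((1 - ρ) / R ^ 2))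
        (sq_nonneg t)
      linarith
    · refine (hρ t h.le ht).trans ?_
      have h4 := Real.add_one_le_exp (-(min (σ ^ 2 / 4) ((1 - ρ) / R ^ 2) * t ^ 2))
      have h5 := mul_le_mul_of_nonneg_right (min_le_right (σ ^ 2 / 4) ((1 - ρ) / R ^ 2))
        (sq_nonneg t)
      have h6 : (1 - ρ) / R ^ 2 * t ^ 2 ≤ 1 - ρ := by
        rw [div_mul_eq_mul_div, div_le_iff₀ (by positivity)]
        have : t ^ 2 ≤ R ^ 2 := by rw [← sq_abs t]; gcongr
        nlinarith
      linarith

/-- Telescoping; keeping the factor `r ^ N` is what preserves Gaussian decay when powers of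
characteristic functions are compared. -/
theorem norm_pow_sub_pow_le_of_norm_le {a b : ℂ} {r : ℝ} (ha : ‖a‖ ≤ r) (hb : ‖b‖ ≤ r) (N : ℕ) :
    ‖a ^ (N + 1) - b ^ (N + 1)‖ ≤ (N + 1) * ‖a - b‖ * r ^ N := by
  have hr : 0 ≤ r := (norm_nonneg _).trans ha
  induction N with
  | zero => simp
  | succ N ih =>
    have e : a ^ (N + 1 + 1) - b ^ (N + 1 + 1)
        = a * (a ^ (N + 1) - b ^ (N + 1)) + (a - b) * b ^ (N + 1) := by ring
    rw [e]
    calc _ ≤ ‖a‖ * ‖a ^ (N + 1) - b ^ (N + 1)‖ + ‖a - b‖ * ‖b‖ ^ (N + 1) := by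
          refine (norm_add_le _ _).trans ?_
          rw [norm_mul, norm_mul, norm_pow]
      _ ≤ r * ((N + 1) * ‖a - b‖ * r ^ N) + ‖a - b‖ * r ^ (N + 1) := by gcongr
      _ = _ := by push_cast; ring

/-- Comparison of powers of a characteristic function with the Gaussian one. -/
theorem exists_norm_charFun_pow_sub_le {μ : Measure ℝ} [IsProbabilityMeasure μ] {σ R : ℝ}
    (h3 : Integrable (fun x => |x| ^ 3) μ) (h1 : ∫ x, x ∂μ = 0) (h2 : ∫ x, x ^ 2 ∂μ = σ ^ 2)
    (hσ : 0 < σ) (hR : 0 < R) (hlt : ∀ t, t ≠ 0 → |t| ≤ R → ‖charFun μ t‖ < 1) :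
    ∃ K c, 0 < K ∧ 0 < c ∧ c ≤ σ ^ 2 / 4 ∧ ∀ N : ℕ, ∀ t, |t| ≤ R →
      ‖charFun μ t ^ (N + 1) - (Real.exp (-((N + 1) * (σ ^ 2 / 2) * t ^ 2)) : ℂ)‖ ≤
        K * (N + 1) * |t| ^ 3 * Real.exp (-(c * (N + 1) * t ^ 2)) := by
  obtain ⟨c, hc0, hcσ, hc⟩ := exists_norm_charFun_le_exp h3 h1 h2 hσ hR hlt
  set M := ∫ x, |x| ^ 3 ∂μ with hM
  have hM0 : 0 ≤ M := integral_nonneg fun x => by positivity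
  refine ⟨(4 * M + σ ^ 4 * R) * Real.exp (c * R ^ 2), c, by positivity, hc0, hcσ,
    fun N t ht => ?_⟩
  have ht0 := abs_nonneg t
  set g : ℝ := Real.exp (-(σ ^ 2 / 2 * t ^ 2)) with hg
  have hgN : Real.exp (-((N + 1) * (σ ^ 2 / 2) * t ^ 2)) = g ^ (N + 1) := by
    rw [hg, ← Real.exp_nat_mul]; congr 1; push_cast; ring
  have hg1 : ‖(g : ℂ)‖ ≤ Real.exp (-(c * t ^ 2)) := by
    rw [Complex.norm_real, Real.norm_of_nonneg (Real.exp_pos _).le]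
    refine Real.exp_le_exp.2 ?_
    nlinarith [sq_nonneg t, mul_le_mul_of_nonneg_right hcσ (sq_nonneg t), sq_nonneg (σ * t)]
  have hg2 : ‖((1 - σ ^ 2 * t ^ 2 / 2 : ℝ) : ℂ) - g‖ ≤ σ ^ 4 * R * |t| ^ 3 := by
    rw [← Complex.ofReal_sub, Complex.norm_real, Real.norm_eq_abs, abs_sub_comm]
    set y := σ ^ 2 / 2 * t ^ 2 with hy
    have hy0 : 0 ≤ y := by positivity
    have ha := Real.add_one_le_exp (-y)
    -- Divide by 1 + y in e^{-y}(1 + y) ≤ 1 ≤ 1 + y³ = (1 - y + y²)(1 + y).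
    have hb : g ≤ 1 - y + y ^ 2 := by
      have h := Real.add_one_le_exp y
      have : g * Real.exp y = 1 := by rw [hg, ← Real.exp_add]; simp
      have hgp : 0 < g := Real.exp_pos _
      have h5 : g * (y + 1) ≤ 1 :=
        (mul_le_mul_of_nonneg_left h hgp.le).trans this.le
      have h6 : 1 ≤ (1 - y + y ^ 2) * (y + 1) := by nlinarith [pow_nonneg hy0 3]
      exact le_of_mul_le_mul_right (h5.trans h6) (by linarith)
    have hc : |g - (1 - σ ^ 2 * t ^ 2 / 2)| ≤ y ^ 2 := by
      rw [abs_le]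
      constructor <;> nlinarith [sq_nonneg y]
    refine hc.trans ?_
    have : y ^ 2 = σ ^ 4 / 4 * |t| * |t| ^ 3 := by
      rw [hy, ← sq_abs t]; ring
    rw [this]
    have hs : 0 ≤ σ ^ 4 := by positivity
    refine mul_le_mul_of_nonneg_right ?_ (by positivity)
    nlinarith
  have hd : ‖charFun μ t - (g : ℂ)‖ ≤ (4 * M + σ ^ 4 * R) * |t| ^ 3 := by
    have := norm_sub_le_norm_sub_add_norm_sub (charFun μ t) ((1 - σ ^ 2 * t ^ 2 / 2 : ℝ) : ℂ) g
    have h' := norm_charFun_sub_taylor_le h3 h1 h2 t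
    rw [← hM] at h'
    linarith
  -- Telescoping leaves only N of the N + 1 Gaussian factors; on |t| ≤ R the missing one costs at
  -- most e^{cR²}.
  have hexp : Real.exp (-(c * t ^ 2)) ^ N
      ≤ Real.exp (c * R ^ 2) * Real.exp (-(c * (N + 1) * t ^ 2)) := by
    rw [← Real.exp_nat_mul, ← Real.exp_add]
    refine Real.exp_le_exp.2 ?_
    have : t ^ 2 ≤ R ^ 2 := by rw [← sq_abs t]; gcongr
    nlinarith
  rw [hgN, Complex.ofReal_pow]
  refine (norm_pow_sub_pow_le_of_norm_le (hc t ht) hg1 N).trans ?_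
  calc _ ≤ (N + 1) * ((4 * M + σ ^ 4 * R) * |t| ^ 3) *
        (Real.exp (c * R ^ 2) * Real.exp (-(c * (N + 1) * t ^ 2))) := by gcongr
    _ = _ := by ring

/-! ### Fourier inversion and the local limit theorem for laws. -/

theorem integral_Icc_cexp_int_mul {h : ℝ} (hh : 0 < h) {k : ℤ} (hk : k ≠ 0) :
    ∫ t in Set.Icc (-(Real.pi / h)) (Real.pi / h),
      Complex.exp (t * (k * h : ℝ) * Complex.I) = 0 := by
  have hpos : 0 < Real.pi / h := by positivity
  rw [integral_Icc_eq_integral_Ioc, ← intervalIntegral.integral_of_le (by linarith)]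
  have hc : ((k * h : ℝ) : ℂ) * Complex.I ≠ 0 := by
    refine mul_ne_zero ?_ Complex.I_ne_zero
    exact_mod_cast mul_ne_zero (Int.cast_ne_zero.2 hk) hh.ne'
  have := integral_exp_mul_complex (a := -(Real.pi / h)) (b := Real.pi / h) hc
  have e : ∀ t : ℝ, Complex.exp (t * (k * h : ℝ) * Complex.I)
      = Complex.exp (((k * h : ℝ) : ℂ) * Complex.I * t) := by
    intro t; congr 1; ring
  simp_rw [e]
  rw [this, div_eq_zero_iff]
  left
  rw [sub_eq_zero, Complex.exp_eq_exp_iff_exists_int]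
  refine ⟨k, ?_⟩
  have hh' : (h : ℂ) ≠ 0 := by exact_mod_cast hh.ne'
  push_cast
  field_simp
  ring

/-- Fourier inversion for a lattice distribution. -/
theorem measureReal_singleton_eq_integral_charFun {ν : Measure ℝ} [IsProbabilityMeasure ν]
    {h x : ℝ} (hh : 0 < h) (hx : ∀ᵐ y ∂ν, ∃ k : ℤ, y - x = k * h) :
    (ν.real {x} : ℂ) = (h / (2 * Real.pi) : ℝ) *
      ∫ t in Set.Icc (-(Real.pi / h)) (Real.pi / h),
        Complex.exp (-(t * x * Complex.I)) * charFun ν t := by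
  have hpos : 0 < Real.pi / h := by positivity
  have h1 : ∀ t : ℝ, Complex.exp (-(t * x * Complex.I)) * charFun ν t
      = ∫ y, Complex.exp (t * (y - x : ℝ) * Complex.I) ∂ν := by
    intro t
    rw [charFun_apply_real, ← integral_const_mul]
    congr 1
    ext y
    rw [← Complex.exp_add]
    congr 1
    push_cast
    ring
  simp_rw [h1]
  rw [integral_integral_swap]
  · have h2 : ∀ᵐ y ∂ν, ∫ t in Set.Icc (-(Real.pi / h)) (Real.pi / h),
        Complex.exp (t * (y - x : ℝ) * Complex.I)
          = Set.indicator {x} (fun _ => ((2 * Real.pi / h : ℝ) : ℂ)) y := by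
      filter_upwards [hx] with y hy
      obtain ⟨k, hk⟩ := hy
      rw [hk]
      by_cases hk0 : k = 0
      · have : y = x := by rw [hk0] at hk; simp at hk; linarith
        subst this
        simp only [hk0, Int.cast_zero, zero_mul, Complex.ofReal_zero, mul_zero, Complex.exp_zero,
          Set.mem_singleton_iff, Set.indicator_of_mem]
        rw [setIntegral_const, Real.volume_real_Icc_of_le (by linarith)]
        simp
        ring
      · rw [integral_Icc_cexp_int_mul hh hk0, Set.indicator_of_notMem]
        intro hyx
        rw [Set.mem_singleton_iff] at hyx
        rw [hyx, sub_self] at hk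
        have := mul_ne_zero (Int.cast_ne_zero.2 hk0) hh.ne'
        exact this hk.symm
    rw [integral_congr_ae h2, integral_indicator (measurableSet_singleton x),
      setIntegral_const]
    have hh' : (h : ℂ) ≠ 0 := by exact_mod_cast hh.ne'
    have hp : (Real.pi : ℂ) ≠ 0 := by exact_mod_cast Real.pi_ne_zero
    rw [Complex.real_smul]
    push_cast
    field_simp
  · refine (integrable_const (1 : ℝ)).mono' (by fun_prop) (ae_of_all _ fun p => ?_)
    simp only [Function.uncurry]
    rw [← Complex.ofReal_mul, Complex.norm_exp_ofReal_mul_I]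

/-- The Gaussian approximation of the probability of a lattice point. -/
noncomputable def latticeGaussian (h σ N x : ℝ) : ℝ :=
  h / (√(2 * Real.pi) * σ * √N) * Real.exp (-x ^ 2 / (2 * σ ^ 2 * N))

theorem integrable_abs_pow_three_mul_exp_neg_mul_sq {c : ℝ} (hc : 0 < c) :
    Integrable (fun t : ℝ => |t| ^ 3 * Real.exp (-(c * t ^ 2))) := by
  have := (integrable_rpow_mul_exp_neg_mul_sq hc (s := 3) (by norm_num)).norm
  refine this.congr (ae_of_all _ fun t => ?_)
  change ‖t ^ (3 : ℝ) * Real.exp (-c * t ^ 2)‖ = _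
  rw [norm_mul, Real.norm_eq_abs, Real.norm_eq_abs, Real.abs_exp]
  have : t ^ (3 : ℝ) = t ^ 3 := by exact_mod_cast Real.rpow_natCast t 3
  rw [this, abs_pow]
  simp

theorem integral_abs_pow_three_mul_exp_neg_mul_sq {c N : ℝ} (hN : 0 < N) :
    ∫ t : ℝ, |t| ^ 3 * Real.exp (-(c * N * t ^ 2))
      = (∫ t : ℝ, |t| ^ 3 * Real.exp (-(c * t ^ 2))) / N ^ 2 := by
  have h := Measure.integral_comp_mul_left (fun t : ℝ => |t| ^ 3 * Real.exp (-(c * t ^ 2))) (√N)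
  have hs : 0 < √N := Real.sqrt_pos.2 hN
  have hsq : √N ^ 2 = N := Real.sq_sqrt hN.le
  have e : ∀ t : ℝ, |√N * t| ^ 3 * Real.exp (-(c * (√N * t) ^ 2))
      = √N ^ 3 * (|t| ^ 3 * Real.exp (-(c * N * t ^ 2))) := by
    intro t
    rw [abs_mul, abs_of_pos hs, mul_pow, mul_pow, hsq, mul_assoc, mul_assoc]
  simp_rw [e] at h
  rw [integral_const_mul, abs_of_pos (inv_pos.2 hs), smul_eq_mul] at h
  rw [eq_div_iff (by positivity)]
  have hN2 : N ^ 2 = √N * √N ^ 3 := by nth_rewrite 1 [← hsq]; ring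
  rw [hN2]
  calc _ = √N * (√N ^ 3 * ∫ t : ℝ, |t| ^ 3 * Real.exp (-(c * N * t ^ 2))) := by ring
    _ = _ := by rw [h]; field_simp

theorem integral_gaussian_fourier_eq {h σ N x : ℝ} (hσ : 0 < σ) (hN : 0 < N) :
    ((h / (2 * Real.pi) : ℝ) : ℂ) * ∫ t : ℝ, Complex.exp (Complex.I * (-x : ℝ) * t) *
      Complex.exp (-(N * (σ ^ 2 / 2) : ℝ) * (t : ℂ) ^ 2) = (latticeGaussian h σ N x : ℂ) := by
  have hb : 0 < N * (σ ^ 2 / 2) := by positivity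
  rw [fourierIntegral_gaussian (by simpa only [Complex.ofReal_re] using hb)]
  have e1 : ((Real.pi : ℂ) / (N * (σ ^ 2 / 2) : ℝ)) ^ (1 / 2 : ℂ)
      = ((√(Real.pi / (N * (σ ^ 2 / 2))) : ℝ) : ℂ) := by
    rw [Real.sqrt_eq_rpow, Complex.ofReal_cpow (by positivity)]
    push_cast
    rfl
  have e2 : Complex.exp (-((-x : ℝ) : ℂ) ^ 2 / (4 * (N * (σ ^ 2 / 2) : ℝ)))
      = ((Real.exp (-x ^ 2 / (2 * σ ^ 2 * N)) : ℝ) : ℂ) := by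
    rw [Complex.ofReal_exp]
    congr 1
    have hσ' : (σ : ℂ) ≠ 0 := by exact_mod_cast hσ.ne'
    have hN' : (N : ℂ) ≠ 0 := by exact_mod_cast hN.ne'
    push_cast
    field_simp
    norm_num
  have e3 : √(Real.pi / (N * (σ ^ 2 / 2))) = √(2 * Real.pi) / (σ * √N) := by
    rw [show Real.pi / (N * (σ ^ 2 / 2)) = (2 * Real.pi) / (σ ^ 2 * N) by field_simp,
      Real.sqrt_div (by positivity), Real.sqrt_mul (sq_nonneg σ), Real.sqrt_sq hσ.le]
  rw [e1, e2, e3, latticeGaussian, ← Complex.ofReal_mul, ← Complex.ofReal_mul]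
  congr 1
  have hp : √(2 * Real.pi) ^ 2 = 2 * Real.pi := Real.sq_sqrt (by positivity)
  have hp0 : 0 < √(2 * Real.pi) := by positivity
  have hN0 : 0 < √N := by positivity
  have : h / (2 * Real.pi) * (√(2 * Real.pi) / (σ * √N)) = h / (√(2 * Real.pi) * σ * √N) := by
    field_simp
    rw [hp]
    ring
  rw [← mul_assoc, this]

/-- Local limit theorem with rate, at the level of laws. -/
theorem exists_abs_measureReal_singleton_sub_le {μ : Measure ℝ} [IsProbabilityMeasure μ]
    {σ h : ℝ} (h3 : Integrable (fun x => |x| ^ 3) μ) (h1 : ∫ x, x ∂μ = 0)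
    (h2 : ∫ x, x ^ 2 ∂μ = σ ^ 2) (hσ : 0 < σ) (hh : 0 < h)
    (hlt : ∀ t, t ≠ 0 → |t| ≤ Real.pi / h → ‖charFun μ t‖ < 1) :
    ∃ C, 0 < C ∧ ∀ N : ℕ, 1 ≤ N → ∀ ν : Measure ℝ, IsProbabilityMeasure ν →
      (∀ t, charFun ν t = charFun μ t ^ N) → ∀ x : ℝ, (∀ᵐ y ∂ν, ∃ k : ℤ, y - x = k * h) →
      |ν.real {x} - latticeGaussian h σ N x| ≤ C / N := by
  set R := Real.pi / h with hRdef
  have hR : 0 < R := by positivity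
  obtain ⟨K, c, hK, hc, hcσ, hb⟩ := exists_norm_charFun_pow_sub_le h3 h1 h2 hσ hR hlt
  set J := ∫ t : ℝ, |t| ^ 3 * Real.exp (-(c * t ^ 2)) with hJ
  have hJ0 : 0 ≤ J := integral_nonneg fun t => by positivity
  refine ⟨h / (2 * Real.pi) * (K + 1 / R ^ 3) * (J + 1), by positivity,
    fun N hN ν hν hch x hx => ?_⟩
  obtain ⟨m, rfl⟩ : ∃ m, N = m + 1 := ⟨N - 1, by omega⟩
  set n : ℝ := ((m + 1 : ℕ) : ℝ) with hn
  have hn1 : 1 ≤ n := by rw [hn]; exact_mod_cast hN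
  have hn0 : 0 < n := by linarith
  have hnm : (m : ℝ) + 1 = n := by rw [hn]; push_cast; ring
  set F : ℝ → ℂ := Set.indicator (Set.Icc (-R) R)
    (fun t => Complex.exp (-(t * x * Complex.I)) * charFun ν t) with hF
  set G : ℝ → ℂ := fun t => Complex.exp (Complex.I * (-x : ℝ) * t) *
      Complex.exp (-(n * (σ ^ 2 / 2) : ℝ) * (t : ℂ) ^ 2) with hG
  have hFi : Integrable F := by
    rw [hF, integrable_indicator_iff measurableSet_Icc]
    refine ContinuousOn.integrableOn_Icc ?_
    have := continuous_charFun (μ := ν)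
    fun_prop
  have hGe : ∀ t : ℝ, G t = Complex.exp (-(t * x * Complex.I)) *
      (Real.exp (-(n * (σ ^ 2 / 2) * t ^ 2)) : ℂ) := by
    intro t
    simp only [hG]
    rw [Complex.ofReal_exp]
    congr 2
    · push_cast; ring
    · push_cast; ring
  have hnorm : ∀ t : ℝ, ‖Complex.exp (-(t * x * Complex.I))‖ = 1 := by
    intro t
    have : -((t : ℂ) * x * Complex.I) = ((-(t * x) : ℝ) : ℂ) * Complex.I := by push_cast; ring
    rw [this, Complex.norm_exp_ofReal_mul_I]
  have hGi : Integrable G := by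
    have hb : 0 < n * (σ ^ 2 / 2) := by positivity
    refine (integrable_exp_neg_mul_sq hb).mono' (by fun_prop) (ae_of_all _ fun t => ?_)
    rw [hGe, norm_mul, hnorm, one_mul, Complex.norm_real, Real.norm_of_nonneg (Real.exp_pos _).le,
      neg_mul]
  -- One bound serves the whole line. For |t| > R only the Gaussian remains, and 1 ≤ |t|³ / R³
  -- brings it to the same form. The integral of |t|³ e^{-cnt²} is of order n^{-2}, so the prefactor
  -- n leaves 1 / n.
  have hbound : ∀ t, ‖F t - G t‖ ≤
      (K + 1 / R ^ 3) * n * (|t| ^ 3 * Real.exp (-(c * n * t ^ 2))) := by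
    intro t
    have ht0 := abs_nonneg t
    rw [hGe]
    by_cases ht : |t| ≤ R
    · have hmem : t ∈ Set.Icc (-R) R := abs_le.1 ht
      rw [hF, Set.indicator_of_mem hmem, ← mul_sub, norm_mul, hnorm, one_mul, hch]
      have h := hb m t ht
      rw [hnm] at h
      refine h.trans ?_
      rw [mul_assoc (K * n)]
      gcongr
      have : 0 < 1 / R ^ 3 := by positivity
      linarith
    · have hmem : t ∉ Set.Icc (-R) R := fun h => ht (abs_le.2 h)
      rw [hF, Set.indicator_of_notMem hmem, zero_sub, norm_neg, norm_mul, hnorm, one_mul,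
        Complex.norm_real, Real.norm_of_nonneg (Real.exp_pos _).le]
      push Not at ht
      have e1 : Real.exp (-(n * (σ ^ 2 / 2) * t ^ 2)) ≤ Real.exp (-(c * n * t ^ 2)) := by
        refine Real.exp_le_exp.2 (neg_le_neg ?_)
        have : c ≤ σ ^ 2 / 2 := by nlinarith [sq_nonneg σ]
        rw [mul_comm c n]
        gcongr
      have e2 : 1 ≤ 1 / R ^ 3 * |t| ^ 3 := by
        rw [div_mul_eq_mul_div, one_mul, one_le_div (by positivity)]
        gcongr
      have e3 : 1 ≤ (K + 1 / R ^ 3) * n * |t| ^ 3 := by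
        have a1 : 0 ≤ |t| ^ 3 := by positivity
        have a2 : 0 < 1 / R ^ 3 := by positivity
        calc 1 ≤ 1 / R ^ 3 * |t| ^ 3 := e2
          _ ≤ (K + 1 / R ^ 3) * |t| ^ 3 := by gcongr; linarith
          _ ≤ (K + 1 / R ^ 3) * n * |t| ^ 3 := by
            refine mul_le_mul_of_nonneg_right ?_ a1
            exact le_mul_of_one_le_right (by positivity) hn1
      rw [← mul_assoc]
      exact e1.trans (le_mul_of_one_le_left (Real.exp_pos _).le e3)
  have hI := norm_integral_le_of_norm_le
    ((integrable_abs_pow_three_mul_exp_neg_mul_sq (mul_pos hc hn0)).const_mul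
      ((K + 1 / R ^ 3) * n)) (ae_of_all _ hbound)
  rw [integral_const_mul, integral_abs_pow_three_mul_exp_neg_mul_sq hn0, ← hJ,
    integral_sub hFi hGi] at hI
  have hinv := measureReal_singleton_eq_integral_charFun hh hx
  rw [← hRdef, ← integral_indicator measurableSet_Icc] at hinv
  have hgau := integral_gaussian_fourier_eq (h := h) (x := x) hσ hn0
  have hdiff : ((ν.real {x} - latticeGaussian h σ n x : ℝ) : ℂ)
      = ((h / (2 * Real.pi) : ℝ) : ℂ) * ((∫ t, F t) - ∫ t, G t) := by
    rw [mul_sub, Complex.ofReal_sub, hinv, ← hgau]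
  rw [← Real.norm_eq_abs, ← Complex.norm_real, hdiff, norm_mul, Complex.norm_real,
    Real.norm_of_nonneg (by positivity)]
  calc _ ≤ h / (2 * Real.pi) * ((K + 1 / R ^ 3) * n * (J / n ^ 2)) := by gcongr
    _ = h / (2 * Real.pi) * (K + 1 / R ^ 3) * J / n := by field_simp
    _ ≤ _ := by gcongr; linarith

/-! ### The local limit theorem for the walk. -/

section RandomWalk

variable {Ω : Type*} [MeasurableSpace Ω] {P : Measure Ω} [IsProbabilityMeasure P]
  {X : ℕ → Ω → ℝ} {h b σ : ℝ}

/-- Maximality of the lattice step keeps the characteristic function away from the unit circle. -/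
theorem IsLatticeValued.norm_charFun_map_lt_one {Y : Ω → ℝ} (hY : AEMeasurable Y P)
    (hl : IsLatticeValued P Y h b) {t : ℝ} (ht0 : t ≠ 0) (ht : |t| ≤ Real.pi / h) :
    ‖charFun (P.map Y) t‖ < 1 := by
  have := Measure.isProbabilityMeasure_map hY
  refine lt_of_le_of_ne (norm_charFun_le_one t) fun heq => ?_
  obtain ⟨d, hd⟩ := ae_mem_lattice_of_norm_charFun_eq_one ht0 heq
  have hd' := ae_of_ae_map hY hd
  have hta : 0 < |t| := abs_pos.2 ht0
  have hsup : SupportedOnLattice P Y (2 * Real.pi / |t|) d := by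
    filter_upwards [hd'] with ω hω
    obtain ⟨k, hk⟩ := hω
    rcases abs_choice t with h1 | h1
    · exact ⟨k, by rw [h1]; exact hk⟩
    · refine ⟨-k, ?_⟩
      rw [h1, hk]
      push_cast
      rw [div_neg]
      ring
  -- Maximality says 2π/|t| ≤ h, while |t| ≤ π/h makes it at least 2h.
  have hle := hl.maximal _ d (by positivity) hsup
  have hh := hl.pos
  rw [div_le_iff₀ hta] at hle
  rw [le_div_iff₀ hh] at ht
  nlinarith [Real.pi_pos]

/-- Arbitrary finite index sets are allowed so that increments of the walk get the same constant as
its endpoints; the characteristic function of the sum depends only on the cardinality. -/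
theorem exists_local_limit (hindep : iIndepFun X P)
    (hident : ∀ i, IdentDistrib (X i) (X 0) P P)
    (hlattice : ∀ i, IsLatticeValued P (X i) h b)
    (hthird : Integrable (fun ω => |X 0 ω| ^ 3) P)
    (hmean : ∫ ω, X 0 ω ∂P = 0) (hσ : 0 < σ)
    (hvar : ∫ ω, X 0 ω ^ 2 ∂P = σ ^ 2) :
    ∃ C, 0 < C ∧ ∀ s : Finset ℕ, s.Nonempty → ∀ k : ℤ,
      |P.real {ω | ∑ i ∈ s, X i ω = k * h + s.card * b} -
        latticeGaussian h σ s.card (k * h + s.card * b)| ≤ C / s.card := by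
  have hmeas : ∀ i, AEMeasurable (X i) P := fun i => (hident i).aemeasurable_fst
  have hm0 := hmeas 0
  have hprob := Measure.isProbabilityMeasure_map hm0
  have i3 : Integrable (fun x : ℝ => |x| ^ 3) (P.map (X 0)) :=
    (integrable_map_measure (by fun_prop) hm0).2 hthird
  have i1 : ∫ x, x ∂(P.map (X 0)) = 0 := by
    rw [integral_map hm0 (by fun_prop)]; exact hmean
  have i2 : ∫ x, x ^ 2 ∂(P.map (X 0)) = σ ^ 2 := by
    rw [integral_map hm0 (by fun_prop)]; exact hvar
  obtain ⟨C, hC, hmain⟩ := exists_abs_measureReal_singleton_sub_le i3 i1 i2 hσ (hlattice 0).pos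
    fun t h0 ht => (hlattice 0).norm_charFun_map_lt_one hm0 h0 ht
  refine ⟨C, hC, fun s hs k => ?_⟩
  have hsm : AEMeasurable (fun ω => ∑ i ∈ s, X i ω) P := by fun_prop
  have hν := Measure.isProbabilityMeasure_map hsm
  have hch : ∀ t, charFun (P.map fun ω => ∑ i ∈ s, X i ω) t
      = charFun (P.map (X 0)) t ^ s.card := by
    intro t
    rw [iIndepFun.charFun_map_fun_finsetSum_eq_prod (fun i _ => hmeas i)
      (hindep.restrict _), Finset.prod_apply,
      Finset.prod_congr rfl fun i _ => by rw [(hident i).map_eq], Finset.prod_const]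
  have hx : ∀ᵐ y ∂(P.map fun ω => ∑ i ∈ s, X i ω),
      ∃ j : ℤ, y - (k * h + s.card * b) = j * h := by
    have hset : MeasurableSet {y : ℝ | ∃ j : ℤ, y - (k * h + s.card * b) = j * h} := by
      have : {y : ℝ | ∃ j : ℤ, y - (k * h + s.card * b) = j * h}
          = Set.range fun j : ℤ => j * h + (k * h + s.card * b) := by
        ext y
        simp only [Set.mem_ofPred_eq, Set.mem_range]
        exact exists_congr fun j => ⟨fun e => by linarith, fun e => by linarith⟩
      rw [this]
      exact (Set.countable_range _).measurableSet
    rw [ae_map_iff hsm hset]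
    have hall : ∀ᵐ ω ∂P, ∀ i, ∃ j : ℤ, X i ω = j * h + b :=
      ae_all_iff.2 fun i => (hlattice i).supported
    filter_upwards [hall] with ω hω
    choose f hf using hω
    refine ⟨∑ i ∈ s, f i - k, ?_⟩
    simp_rw [hf]
    rw [Finset.sum_add_distrib, ← Finset.sum_mul, Finset.sum_const, nsmul_eq_mul]
    push_cast
    ring
  have := hmain s.card hs.card_pos _ hν hch _ hx
  rwa [Measure.real, Measure.map_apply_of_aemeasurable hsm (measurableSet_singleton _)] at this

end RandomWalk

/-! ### Gaussian weights and rounding to the lattice. -/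

theorem abs_exp_neg_sq_sub_le (u v : ℝ) :
    |Real.exp (-u ^ 2) - Real.exp (-v ^ 2)| ≤ 2 * |u - v| := by
  have hd : ∀ x : ℝ, HasDerivAt (fun x : ℝ => Real.exp (-x ^ 2))
      (Real.exp (-x ^ 2) * (-(2 * x))) x := by
    intro x
    have := ((hasDerivAt_pow 2 x).neg).exp
    simpa using this
  have hb : ∀ x : ℝ, ‖Real.exp (-x ^ 2) * (-(2 * x))‖ ≤ 2 := by
    intro x
    rw [norm_mul, Real.norm_of_nonneg (Real.exp_pos _).le, Real.norm_eq_abs, abs_neg, abs_mul,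
      abs_two]
    have h1 : Real.exp (-x ^ 2) * Real.exp (x ^ 2) = 1 := by rw [← Real.exp_add]; simp
    have h2 := Real.add_one_le_exp (x ^ 2)
    have h3 : |x| ≤ Real.exp (x ^ 2) := by
      rw [← sq_abs x] at h2 ⊢
      nlinarith [sq_nonneg (|x| - 1), sq_nonneg |x|]
    have h4 := mul_le_mul_of_nonneg_left h3 (Real.exp_pos (-x ^ 2)).le
    linarith
  have := Convex.norm_image_sub_le_of_norm_hasDerivWithin_le (s := Set.univ) (C := 2)
    (fun x _ => (hd x).hasDerivWithinAt) (fun x _ => hb x) convex_univ (Set.mem_univ v)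
    (Set.mem_univ u)
  simpa [Real.norm_eq_abs] using this

/-- Rounding a target to the lattice moves it by a bounded amount, so this Lipschitz bound makes the
rounding cost O(1 / N), the same order as the local limit error. -/
theorem abs_latticeGaussian_sub_le {h σ N : ℝ} (hh : 0 < h) (hσ : 0 < σ) (hN : 0 < N) (x y : ℝ) :
    |latticeGaussian h σ N x - latticeGaussian h σ N y| ≤ h / σ ^ 2 * |x - y| / N := by
  have hs : 0 < √N := Real.sqrt_pos.2 hN
  have hs2 : √N ^ 2 = N := Real.sq_sqrt hN.le
  have ht : 0 < √(2 : ℝ) := by positivity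
  have ht2 : √(2 : ℝ) ^ 2 = 2 := Real.sq_sqrt (by norm_num)
  have e : ∀ z : ℝ, -z ^ 2 / (2 * σ ^ 2 * N) = -(z / (√2 * σ * √N)) ^ 2 := by
    intro z
    rw [div_pow, mul_pow, mul_pow, hs2, ht2]
    ring
  rw [latticeGaussian, latticeGaussian, ← mul_sub, abs_mul, e, e, abs_of_pos (by positivity)]
  have h1 := abs_exp_neg_sq_sub_le (x / (√2 * σ * √N)) (y / (√2 * σ * √N))
  rw [← sub_div, abs_div, abs_of_pos (a := √2 * σ * √N) (by positivity)] at h1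
  have hpi : √2 ≤ √(2 * Real.pi) := Real.sqrt_le_sqrt (by linarith [Real.pi_gt_three])
  calc _ ≤ h / (√(2 * Real.pi) * σ * √N) * (2 * (|x - y| / (√2 * σ * √N))) := by gcongr
    _ ≤ h / (√2 * σ * √N) * (2 * (|x - y| / (√2 * σ * √N))) := by gcongr
    _ = h * |x - y| * 2 / (√2 ^ 2 * σ ^ 2 * √N ^ 2) := by field_simp
    _ = _ := by rw [hs2, ht2]; field_simp

theorem latticeGaussian_le {h σ N : ℝ} (hh : 0 < h) (hσ : 0 < σ) (hN : 0 ≤ N) (x : ℝ) :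
    latticeGaussian h σ N x ≤ h / (√(2 * Real.pi) * σ) / √N := by
  rw [latticeGaussian, div_div]
  refine mul_le_of_le_one_right (by positivity) (Real.exp_le_one_iff.2 ?_)
  exact div_nonpos_of_nonpos_of_nonneg (by nlinarith [sq_nonneg x]) (by positivity)

theorem latticeGaussian_mul_sqrt {h σ N a : ℝ} (hσ : 0 < σ) (hN : 0 < N) :
    latticeGaussian h σ N (a * σ * √N) = hitLimit h σ a / √N := by
  have hs2 : √N ^ 2 = N := Real.sq_sqrt hN.le
  rw [latticeGaussian, hitLimit, mul_pow, mul_pow, hs2]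
  have : -(a ^ 2 * σ ^ 2 * N) / (2 * σ ^ 2 * N) = -a ^ 2 / 2 := by field_simp
  rw [this]
  field_simp

theorem latticePoint_le {h : ℝ} (hh : 0 < h) (b : ℝ) (n : ℕ) (x : ℝ) :
    latticePoint h b n x ≤ x := by
  have := Int.floor_le ((x - n * b) / h)
  rw [le_div_iff₀ hh] at this
  rw [latticePoint]; linarith

theorem lt_latticePoint_add {h : ℝ} (hh : 0 < h) (b : ℝ) (n : ℕ) (x : ℝ) :
    x < latticePoint h b n x + h := by
  have := Int.lt_floor_add_one ((x - n * b) / h)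
  rw [div_lt_iff₀ hh] at this
  rw [latticePoint]; linarith

/-- Comparison of the Gaussian weights of an increment and of the endpoint. -/
theorem latticeGaussian_increment_le {h σ a u v w : ℝ} (hh : 0 < h) (hσ : 0 < σ) (hv : 0 < v)
    (hw : 0 < w) (hu : 0 < u) (huv : u ^ 2 = v ^ 2 + w ^ 2) :
    latticeGaussian h σ (w ^ 2) (a * σ * (u - v)) ≤
      hitLimit h σ a / u + h / (√(2 * Real.pi) * σ) * (v / (u * w) + a ^ 2 * v / u ^ 2) := by
  have hvu : v < u := by nlinarith [sq_nonneg (u - v), mul_pos hw hw]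
  rw [latticeGaussian, hitLimit, Real.sqrt_sq hw.le]
  set κ := h / (√(2 * Real.pi) * σ) with hκ
  have hκ0 : 0 < κ := by positivity
  have hfac : h / (√(2 * Real.pi) * σ * w) = κ / w := by rw [hκ, div_div]
  -- Here u, v, w stand for √n, √m, √(n - m). Since w² = (u - v)(u + v), the exponent is -(a²/2)(u -
  -- v)/(u + v).
  have hexp : -(a * σ * (u - v)) ^ 2 / (2 * σ ^ 2 * w ^ 2)
      = -a ^ 2 / 2 + a ^ 2 * (v / (u + v)) := by
    have hw2 : w ^ 2 = (u - v) * (u + v) := by linarith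
    have h1 : u - v ≠ 0 := by linarith
    have h2 : u + v ≠ 0 := by linarith
    rw [hw2]
    field_simp
    ring
  rw [hfac, hexp]
  set e := Real.exp (-a ^ 2 / 2 + a ^ 2 * (v / (u + v))) with he
  set E := Real.exp (-a ^ 2 / 2) with hE
  have he0 : 0 < e := Real.exp_pos _
  have he1 : e ≤ 1 := by
    rw [he, Real.exp_le_one_iff]
    have : v / (u + v) ≤ 1 / 2 := by
      rw [div_le_iff₀ (by linarith)]; linarith
    nlinarith [sq_nonneg a]
  have heE : e - E ≤ a ^ 2 * (v / u) := by
    have h1 := Real.add_one_le_exp (-(a ^ 2 * (v / (u + v))))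
    have h2 : E = e * Real.exp (-(a ^ 2 * (v / (u + v)))) := by
      rw [hE, he, ← Real.exp_add]; congr 1; ring
    have h3 : e * (-(a ^ 2 * (v / (u + v))) + 1) ≤ E := by
      rw [h2]; exact mul_le_mul_of_nonneg_left h1 he0.le
    have h4 : v / (u + v) ≤ v / u := by gcongr; linarith
    have h5 : 0 ≤ v / (u + v) := by positivity
    have h6 : e * (a ^ 2 * (v / (u + v))) ≤ a ^ 2 * (v / (u + v)) :=
      mul_le_of_le_one_left (by positivity) he1
    have h7 : a ^ 2 * (v / (u + v)) ≤ a ^ 2 * (v / u) := by gcongr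
    linarith
  have huw : u ≤ v + w := by nlinarith [mul_pos hv hw]
  have hwu : w ≤ u := by nlinarith [sq_nonneg (u - w), mul_pos hv hv]
  -- The triangle inequality u ≤ v + w gives 1/w - 1/u ≤ v/(uw).
  have h1 : e / w ≤ e / u + v / (u * w) := by
    have : e / w - e / u = e * ((u - w) / (u * w)) := by field_simp
    have h2 : e * ((u - w) / (u * w)) ≤ (u - w) / (u * w) := by
      refine mul_le_of_le_one_left ?_ he1
      exact div_nonneg (by linarith) (by positivity)
    have h3 : (u - w) / (u * w) ≤ v / (u * w) := by gcongr; linarith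
    linarith
  have h2 : e / u ≤ E / u + a ^ 2 * v / u ^ 2 := by
    have : a ^ 2 * v / u ^ 2 = a ^ 2 * (v / u) / u := by field_simp
    rw [this, ← add_div]
    gcongr
    linarith
  calc κ / w * e = κ * (e / w) := by ring
    _ ≤ κ * (E / u + (v / (u * w) + a ^ 2 * v / u ^ 2)) := by gcongr; linarith
    _ = _ := by ring

/-! ### Hitting probabilities and pair moments. -/

section RandomWalk

variable {Ω : Type*} [MeasurableSpace Ω] {P : Measure Ω}
  {X : ℕ → Ω → ℝ} {h b σ : ℝ}

/-- A local limit bound with rate `C / n` for the sums of `X` over finite sets of indices. -/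
def HasLocalLimit (P : Measure Ω) (X : ℕ → Ω → ℝ) (h b σ C : ℝ) : Prop :=
  ∀ s : Finset ℕ, s.Nonempty → ∀ k : ℤ,
    |P.real {ω | ∑ i ∈ s, X i ω = k * h + s.card * b} -
      latticeGaussian h σ s.card (k * h + s.card * b)| ≤ C / s.card

theorem HasLocalLimit.abs_hitEvent_sub_le {C : ℝ} (hL : HasLocalLimit P X h b σ C) (hh : 0 < h)
    (hσ : 0 < σ) (a : ℝ) {n : ℕ} (hn : 0 < n) :
    |P.real (hitEvent X h b (a * σ) n) - hitLimit h σ a / √n| ≤ (C + 2 * h ^ 2 / σ ^ 2) / n := by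
  have hn' : (0 : ℝ) < n := by exact_mod_cast hn
  have h1 := hL (Finset.range n) (Finset.nonempty_range_iff.2 hn.ne')
    ⌊(a * σ * √n - n * b) / h⌋
  rw [Finset.card_range] at h1
  change |P.real (hitEvent X h b (a * σ) n)
    - latticeGaussian h σ n (latticePoint h b n (a * σ * √n))| ≤ _ at h1
  have h2 := abs_latticeGaussian_sub_le hh hσ hn' (latticePoint h b n (a * σ * √n)) (a * σ * √n)
  rw [latticeGaussian_mul_sqrt hσ hn'] at h2
  have h3 : |latticePoint h b n (a * σ * √n) - a * σ * √n| ≤ 2 * h := by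
    have := latticePoint_le hh b n (a * σ * √n)
    have := lt_latticePoint_add hh b n (a * σ * √n)
    rw [abs_le]; constructor <;> linarith
  have h4 : h / σ ^ 2 * |latticePoint h b n (a * σ * √n) - a * σ * √n| / n
      ≤ h / σ ^ 2 * (2 * h) / n := by gcongr
  refine (abs_sub_le _ _ _).trans ((add_le_add h1 (h2.trans h4)).trans (le_of_eq ?_))
  ring

theorem HasLocalLimit.hitEvent_le {C : ℝ} (hL : HasLocalLimit P X h b σ C) (hC : 0 < C)
    (hh : 0 < h) (hσ : 0 < σ) (c : ℝ) {n : ℕ} (hn : 0 < n) :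
    P.real (hitEvent X h b c n) ≤ (C + h / (√(2 * Real.pi) * σ)) / √n := by
  have hn' : (0 : ℝ) < n := by exact_mod_cast hn
  have h1 := hL (Finset.range n) (Finset.nonempty_range_iff.2 hn.ne') ⌊(c * √n - n * b) / h⌋
  rw [Finset.card_range] at h1
  change |P.real (hitEvent X h b c n)
    - latticeGaussian h σ n (latticePoint h b n (c * √n))| ≤ _ at h1
  have h2 := latticeGaussian_le hh hσ hn'.le (latticePoint h b n (c * √n))
  have h3 : C / n ≤ C / √n := by
    have : √(n : ℝ) ≤ n := Real.sqrt_le_self_iff.2 (Or.inr (by exact_mod_cast hn))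
    have : 0 < √(n : ℝ) := Real.sqrt_pos.2 hn'
    gcongr
  have := (abs_le.1 h1).2
  rw [add_div]
  linarith

/-- The Gaussian corrections carry a factor √m, which will cancel the O(1 / √m) probability of the
hit at time m; the rounding and local limit errors together give the last term. -/
theorem HasLocalLimit.increment_le {C : ℝ} (hL : HasLocalLimit P X h b σ C) (hh : 0 < h)
    (hσ : 0 < σ) (a : ℝ) {m n : ℕ} (hm : 0 < m) (hmn : m < n) :
    P.real {ω | ∑ i ∈ Finset.Ico m n, X i ω =
        latticePoint h b n (a * σ * √n) - latticePoint h b m (a * σ * √m)} ≤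
      hitLimit h σ a / √n + h / (√(2 * Real.pi) * σ) *
        (√m / (√n * √(n - m)) + a ^ 2 * √m / n) + (C + 2 * h ^ 2 / σ ^ 2) / (n - m) := by
  have hm' : (0 : ℝ) < m := by exact_mod_cast hm
  have hn' : (0 : ℝ) < n := by exact_mod_cast hm.trans hmn
  have hd : (0 : ℝ) < n - m := sub_pos.2 (by exact_mod_cast hmn)
  have h1 := hL (Finset.Ico m n) (Finset.nonempty_Ico.2 hmn)
    (⌊(a * σ * √n - n * b) / h⌋ - ⌊(a * σ * √m - m * b) / h⌋)
  rw [Nat.card_Ico, Nat.cast_sub hmn.le] at h1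
  have e : (((⌊(a * σ * √n - n * b) / h⌋ - ⌊(a * σ * √m - m * b) / h⌋ : ℤ) : ℝ) * h +
      ((n : ℝ) - m) * b)
      = latticePoint h b n (a * σ * √n) - latticePoint h b m (a * σ * √m) := by
    simp only [latticePoint]; push_cast; ring
  rw [e] at h1
  have h2 := abs_latticeGaussian_sub_le hh hσ hd
    (latticePoint h b n (a * σ * √n) - latticePoint h b m (a * σ * √m)) (a * σ * (√n - √m))
  have h3 : |latticePoint h b n (a * σ * √n) - latticePoint h b m (a * σ * √m)
      - a * σ * (√n - √m)| ≤ 2 * h := by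
    have := latticePoint_le hh b n (a * σ * √n)
    have := lt_latticePoint_add hh b n (a * σ * √n)
    have := latticePoint_le hh b m (a * σ * √m)
    have := lt_latticePoint_add hh b m (a * σ * √m)
    rw [abs_le]; constructor <;> linarith
  have h4 : h / σ ^ 2 * |latticePoint h b n (a * σ * √n) - latticePoint h b m (a * σ * √m)
      - a * σ * (√n - √m)| / (n - m) ≤ h / σ ^ 2 * (2 * h) / (n - m) := by gcongr
  have h5 := latticeGaussian_increment_le (a := a) hh hσ (Real.sqrt_pos.2 hm')
    (Real.sqrt_pos.2 hd) (Real.sqrt_pos.2 hn') (by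
      rw [Real.sq_sqrt hm'.le, Real.sq_sqrt hd.le, Real.sq_sqrt hn'.le]; ring)
  rw [Real.sq_sqrt hd.le, Real.sq_sqrt hn'.le] at h5
  have h6 := (abs_le.1 h1).2
  have h7 := (abs_le.1 h2).2
  have h8 : (C + 2 * h ^ 2 / σ ^ 2) / ((n : ℝ) - m)
      = C / (n - m) + h / σ ^ 2 * (2 * h) / (n - m) := by ring
  rw [h8]
  linarith

theorem nullMeasurableSet_hitEvent (hmeas : ∀ i, AEMeasurable (X i) P) (c : ℝ) (n : ℕ) :
    NullMeasurableSet (hitEvent X h b c n) P := by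
  have : AEMeasurable (fun ω => partialSum X n ω) P := by
    unfold partialSum; fun_prop
  exact this.nullMeasurable (measurableSet_singleton _)

/-- Once S_m is at its target, hitting at time n prescribes the increment S_n - S_m, which is
independent of S_m. -/
theorem measureReal_hitEvent_inter (hindep : iIndepFun X P) (hmeas : ∀ i, AEMeasurable (X i) P)
    (c : ℝ) {m n : ℕ} (hmn : m ≤ n) :
    P.real (hitEvent X h b c m ∩ hitEvent X h b c n) =
      P.real (hitEvent X h b c m) * P.real {ω | ∑ i ∈ Finset.Ico m n, X i ω =
        latticePoint h b n (c * √n) - latticePoint h b m (c * √m)} := by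
  have hdis : Disjoint (Finset.range m) (Finset.Ico m n) := by
    rw [Finset.disjoint_left]
    intro i hi hi'
    rw [Finset.mem_range] at hi
    rw [Finset.mem_Ico] at hi'
    omega
  have hI := hindep.indepFun_finset₀ _ _ hdis hmeas
  have hI' : IndepFun (fun ω => ∑ i ∈ Finset.range m, X i ω)
      (fun ω => ∑ i ∈ Finset.Ico m n, X i ω) P := by
    have := hI.comp (φ := fun f => ∑ i, f i) (ψ := fun f => ∑ i, f i) (by fun_prop) (by fun_prop)
    convert this using 1
    · ext ω
      exact (Finset.sum_coe_sort (Finset.range m) (fun i => X i ω)).symm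
    · ext ω
      exact (Finset.sum_coe_sort (Finset.Ico m n) (fun i => X i ω)).symm
  have hset : hitEvent X h b c m ∩ hitEvent X h b c n =
      (fun ω => ∑ i ∈ Finset.range m, X i ω) ⁻¹' {latticePoint h b m (c * √m)} ∩
      (fun ω => ∑ i ∈ Finset.Ico m n, X i ω) ⁻¹'
        {latticePoint h b n (c * √n) - latticePoint h b m (c * √m)} := by
    ext ω
    have hs := Finset.sum_range_add_sum_Ico (fun i => X i ω) hmn
    simp only [hitEvent, partialSum, Set.mem_inter_iff, Set.mem_ofPred_eq, Set.mem_preimage,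
      Set.mem_singleton_iff]
    constructor
    · rintro ⟨h1, h2⟩
      exact ⟨h1, by linarith⟩
    · rintro ⟨h1, h2⟩
      exact ⟨h1, by linarith⟩
  have := hI'.measure_inter_preimage_eq_mul {latticePoint h b m (c * √m)}
    {latticePoint h b n (c * √n) - latticePoint h b m (c * √m)}
    (measurableSet_singleton _) (measurableSet_singleton _)
  rw [hset, Measure.real, this, ENNReal.toReal_mul]
  rfl

theorem integral_indicator_sub_mul_indicator_sub [IsProbabilityMeasure P] {A B : Set Ω}
    (hA : NullMeasurableSet A P)
    (hB : NullMeasurableSet B P) (x y : ℝ) :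
    ∫ ω, (A.indicator (fun _ => (1 : ℝ)) ω - x) * (B.indicator (fun _ => (1 : ℝ)) ω - y) ∂P =
      P.real (A ∩ B) - x * P.real B - y * P.real A + x * y := by
  have hi : ∀ {S : Set Ω}, NullMeasurableSet S P →
      Integrable (S.indicator fun _ => (1 : ℝ)) P := fun hS =>
    (integrable_const (1 : ℝ)).indicator₀ hS
  have hv : ∀ {S : Set Ω}, NullMeasurableSet S P →
      ∫ ω, S.indicator (fun _ => (1 : ℝ)) ω ∂P = P.real S := fun hS => by
    rw [integral_indicator₀ hS, setIntegral_const]; simp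
  have e : ∀ ω, (A.indicator (fun _ => (1 : ℝ)) ω - x) * (B.indicator (fun _ => (1 : ℝ)) ω - y)
      = (A ∩ B).indicator (fun _ => (1 : ℝ)) ω - x * B.indicator (fun _ => (1 : ℝ)) ω
        - y * A.indicator (fun _ => (1 : ℝ)) ω + x * y := by
    intro ω
    by_cases h1 : ω ∈ A <;> by_cases h2 : ω ∈ B <;> simp [h1, h2] <;> ring
  simp_rw [e]
  have i1 : Integrable (fun ω => (A ∩ B).indicator (fun _ => (1 : ℝ)) ω) P := hi (hA.inter hB)
  have i2 : Integrable (fun ω => x * B.indicator (fun _ => (1 : ℝ)) ω) P := (hi hB).const_mul x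
  have i3 : Integrable (fun ω => y * A.indicator (fun _ => (1 : ℝ)) ω) P := (hi hA).const_mul y
  rw [integral_add (f := fun ω => (A ∩ B).indicator (fun _ => (1 : ℝ)) ω -
      x * B.indicator (fun _ => (1 : ℝ)) ω - y * A.indicator (fun _ => (1 : ℝ)) ω)
      ((i1.sub i2).sub i3) (integrable_const _),
    integral_sub (f := fun ω => (A ∩ B).indicator (fun _ => (1 : ℝ)) ω -
      x * B.indicator (fun _ => (1 : ℝ)) ω) (i1.sub i2) i3,
    integral_sub i1 i2, integral_const_mul, integral_const_mul, hv (hA.inter hB), hv hA, hv hB]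
  simp

/-- The hitting indicator at time `n`, centred at its asymptotic mean. -/
noncomputable def centredHit (X : ℕ → Ω → ℝ) (h b σ a : ℝ) (n : ℕ) (ω : Ω) : ℝ :=
  (hitEvent X h b (a * σ) n).indicator (fun _ => (1 : ℝ)) ω - hitLimit h σ a / √n

theorem hitLimit_le {a : ℝ} (hh : 0 < h) (hσ : 0 < σ) :
    hitLimit h σ a ≤ h / (√(2 * Real.pi) * σ) := by
  rw [hitLimit]
  refine mul_le_of_le_one_right (by positivity) (Real.exp_le_one_iff.2 ?_)
  nlinarith [sq_nonneg a]

theorem hitLimit_pos {a : ℝ} (hh : 0 < h) (hσ : 0 < σ) : 0 < hitLimit h σ a := by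
  rw [hitLimit]; positivity

/-- Off-diagonal second moment bound. -/
theorem HasLocalLimit.exists_integral_centredHit_mul_le [IsProbabilityMeasure P] {C : ℝ}
    (hL : HasLocalLimit P X h b σ C)
    (hC : 0 < C) (hindep : iIndepFun X P) (hmeas : ∀ i, AEMeasurable (X i) P) (hh : 0 < h)
    (hσ : 0 < σ) :
    ∃ K, 0 < K ∧ (∀ a : ℝ, ∀ m n : ℕ, 0 < m → m < n →
      ∫ ω, centredHit X h b σ a m ω * centredHit X h b σ a n ω ∂P ≤
        K * (1 / (√n * √(n - m)) + a ^ 2 / n + 1 / (√m * (n - m)))) ∧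
      (∀ a : ℝ, ∀ n : ℕ, 0 < n → ∫ ω, centredHit X h b σ a n ω ^ 2 ∂P ≤ K / √n) := by
  set κ := h / (√(2 * Real.pi) * σ) with hκ
  have hκ0 : 0 < κ := by positivity
  set C₁ := C + 2 * h ^ 2 / σ ^ 2 with hC₁
  have hC₁0 : 0 < C₁ := by positivity
  set C₂ := C + κ with hC₂
  have hC₂0 : 0 < C₂ := by positivity
  refine ⟨C₂ * κ + C₂ * C₁ + κ * C₁ + C₂ + κ ^ 2, by positivity, ?_, ?_⟩
  · intro a m n hm hmn
    have hm' : (0 : ℝ) < m := by exact_mod_cast hm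
    have hn' : (0 : ℝ) < n := by exact_mod_cast hm.trans hmn
    have hd : (0 : ℝ) < n - m := sub_pos.2 (by exact_mod_cast hmn)
    have hu := Real.sqrt_pos.2 hn'
    have hv := Real.sqrt_pos.2 hm'
    have hw := Real.sqrt_pos.2 hd
    have hN := fun k => nullMeasurableSet_hitEvent (h := h) (b := b) hmeas (a * σ) k
    simp only [centredHit]
    rw [integral_indicator_sub_mul_indicator_sub (hN m) (hN n),
      measureReal_hitEvent_inter hindep hmeas _ hmn.le]
    have hinc := hL.increment_le hh hσ a hm hmn
    have hpm := hL.hitEvent_le hC hh hσ (a * σ) hm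
    have hpn := (abs_le.1 (hL.abs_hitEvent_sub_le hh hσ a (hm.trans hmn))).1
    have hpm0 : 0 ≤ P.real (hitEvent X h b (a * σ) m) := measureReal_nonneg
    set pm := P.real (hitEvent X h b (a * σ) m)
    set pn := P.real (hitEvent X h b (a * σ) n)
    set pc := P.real {ω | ∑ i ∈ Finset.Ico m n, X i ω =
        latticePoint h b n (a * σ * √n) - latticePoint h b m (a * σ * √m)}
    have hl1 := hitLimit_le (a := a) hh hσ
    have hl0 := hitLimit_pos (a := a) hh hσ
    set l := hitLimit h σ a
    rw [← hκ, ← hC₁] at *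
    rw [← hC₂] at hpm
    set U := κ * (√m / (√n * √(n - m)) + a ^ 2 * √m / n) + C₁ / (n - m) with hU
    have hU0 : 0 ≤ U := by positivity
    -- Grouped this way, the moment needs only an upper bound for the increment probability and a
    -- lower bound for the hit at time n.
    have e1 : pm * pc - l / √m * pn - l / √n * pm + l / √m * (l / √n)
        = pm * (pc - l / √n) + l / √m * (l / √n - pn) := by ring
    rw [e1]
    have b1 : pm * (pc - l / √n) ≤ C₂ / √m * U :=
      (mul_le_mul_of_nonneg_left (by linarith) hpm0).trans
        (mul_le_mul_of_nonneg_right hpm hU0)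
    have b2 : l / √m * (l / √n - pn) ≤ κ / √m * (C₁ / (n - m)) := by
      have : C₁ / (n : ℝ) ≤ C₁ / (n - m) := by gcongr; linarith
      have h2 : l / √n - pn ≤ C₁ / (n - m) := by linarith
      exact (mul_le_mul_of_nonneg_left h2 (by positivity)).trans (by gcongr)
    have e2 : C₂ / √m * U + κ / √m * (C₁ / (n - m))
        = C₂ * κ * (1 / (√n * √(n - m))) + C₂ * κ * (a ^ 2 / n)
          + (C₂ * C₁ + κ * C₁) * (1 / (√m * (n - m))) := by
      rw [hU]; field_simp; ring
    refine (add_le_add b1 b2).trans (e2.le.trans ?_)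
    clear_value C₂ C₁ κ
    rw [mul_add, mul_add]
    have p1 : 0 < C₂ * κ := by positivity
    have p2 : 0 < C₂ * C₁ := by positivity
    have p3 : 0 < κ * C₁ := by positivity
    have p4 : 0 < κ ^ 2 := by positivity
    refine add_le_add (add_le_add ?_ ?_) ?_ <;>
      exact mul_le_mul_of_nonneg_right (by linarith) (by positivity)
  · intro a n hn
    have hn' : (0 : ℝ) < n := by exact_mod_cast hn
    have hu := Real.sqrt_pos.2 hn'
    have hN := nullMeasurableSet_hitEvent (h := h) (b := b) hmeas (a * σ) n
    simp only [centredHit, sq]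
    rw [integral_indicator_sub_mul_indicator_sub hN hN, Set.inter_self]
    have hp := hL.hitEvent_le hC hh hσ (a * σ) hn
    have hp0 : 0 ≤ P.real (hitEvent X h b (a * σ) n) := measureReal_nonneg
    have hl1 := hitLimit_le (a := a) hh hσ
    have hl0 := hitLimit_pos (a := a) hh hσ
    set l := hitLimit h σ a
    set p := P.real (hitEvent X h b (a * σ) n)
    rw [← hκ] at *
    have h1 : 0 ≤ l / √n * p := by positivity
    have h2 : l / √n * (l / √n) ≤ κ ^ 2 / √n := by
      have : 1 ≤ √(n : ℝ) := Real.one_le_sqrt.2 (by exact_mod_cast hn)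
      calc l / √n * (l / √n) ≤ κ / √n * (κ / 1) := by gcongr
        _ = _ := by ring
    have h3 : C₂ / √n + κ ^ 2 / √n ≤ (C₂ * κ + C₂ * C₁ + κ * C₁ + C₂ + κ ^ 2) / √n := by
      rw [← add_div]
      gcongr
      have : 0 < C₂ * κ + C₂ * C₁ + κ * C₁ := by positivity
      linarith
    rw [← hC₂] at hp
    rw [sq κ] at *
    linarith

end RandomWalk

/-! ### Growth of the times and column sums. -/

/-- Telescoping from 1/√d ≤ 2(√d - √(d-1)); the upper limit `k` is separated from `j` to permit
induction. -/
theorem sum_Ico_inv_sqrt_sub_le (j : ℕ) {k : ℕ} (hk : 1 ≤ k) (hkj : k ≤ j) :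
    ∑ i ∈ Finset.Ico 1 k, 1 / √((j : ℝ) - i) ≤ 2 * (√((j : ℝ) - 1) - √((j : ℝ) - k)) := by
  induction k, hk using Nat.le_induction with
  | base => simp
  | succ k hk ih =>
    rw [Finset.sum_Ico_succ_top hk]
    have ih := ih (by omega)
    have hd : (1 : ℝ) ≤ j - k := by
      have : ((k + 1 : ℕ) : ℝ) ≤ j := by exact_mod_cast hkj
      push_cast at this; linarith
    have h1 : 1 / √((j : ℝ) - k) ≤ 2 * (√((j : ℝ) - k) - √((j : ℝ) - (k + 1 : ℕ))) := by
      have e : (j : ℝ) - (k + 1 : ℕ) = (j - k) - 1 := by push_cast; ring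
      rw [e]
      set d := (j : ℝ) - k
      have hs : 0 < √d := Real.sqrt_pos.2 (by linarith)
      have hs2 : √d ^ 2 = d := Real.sq_sqrt (by linarith)
      have ht2 : √(d - 1) ^ 2 = d - 1 := Real.sq_sqrt (by linarith)
      rw [div_le_iff₀ hs]
      nlinarith [sq_nonneg (√d - √(d - 1))]
    linarith

/-- A gap condition of order `√n` makes `√n` grow at least linearly. -/
theorem exists_le_sqrt_sub_sqrt {n : ℕ → ℕ} (hpos : ∀ i, 1 ≤ i → 0 < n i) {A : ℝ} (hA : 0 < A)
    (hgap : ∀ i, 1 ≤ i → A * √(n i : ℝ) ≤ (n (i + 1) : ℝ) - n i) :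
    ∃ c : ℝ, 0 < c ∧ c ≤ 1 ∧ ∀ i, 1 ≤ i → c ≤ √(n (i + 1) : ℝ) - √(n i : ℝ) := by
  refine ⟨min (A / 3) 1, by positivity, min_le_right _ _, fun i hi => ?_⟩
  have hg := hgap i hi
  have h1 : 1 ≤ √(n i : ℝ) := Real.one_le_sqrt.2 (by exact_mod_cast hpos i hi)
  set u := √(n i : ℝ) with hu
  set v := √(n (i + 1) : ℝ) with hv
  have hu2 : u ^ 2 = n i := Real.sq_sqrt (Nat.cast_nonneg _)
  have hv2 : v ^ 2 = n (i + 1) := Real.sq_sqrt (Nat.cast_nonneg _)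
  have hv0 : 0 ≤ v := Real.sqrt_nonneg _
  rw [← hu2, ← hv2] at hg
  -- If v ≤ 2u, divide v² - u² ≥ Au by u + v ≤ 3u; otherwise v - u > u ≥ 1.
  rcases le_or_gt v (2 * u) with h | h
  · refine (min_le_left _ _).trans ?_
    have h2 : u < v := by nlinarith [mul_pos hA (by linarith : 0 < u)]
    have h3 : A * u ≤ (v - u) * (3 * u) := by nlinarith
    have h4 : A ≤ (v - u) * 3 := le_of_mul_le_mul_right (by linarith) (by linarith : 0 < u)
    linarith
  · refine (min_le_right _ _).trans ?_
    linarith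

section Growth

variable {n : ℕ → ℕ} {c : ℝ}

theorem mul_sub_le_sqrt_sub_sqrt (hc : ∀ i, 1 ≤ i → c ≤ √(n (i + 1) : ℝ) - √(n i : ℝ)) {i j : ℕ}
    (hi : 1 ≤ i) (hij : i ≤ j) : c * ((j : ℝ) - i) ≤ √(n j : ℝ) - √(n i : ℝ) := by
  induction j, hij using Nat.le_induction with
  | base => simp
  | succ j hij ih =>
    have := hc j (hi.trans hij)
    push_cast
    linarith

theorem mul_le_sqrt (hpos : ∀ i, 1 ≤ i → 0 < n i) (hc1 : c ≤ 1)
    (hc : ∀ i, 1 ≤ i → c ≤ √(n (i + 1) : ℝ) - √(n i : ℝ)) {j : ℕ} (hj : 1 ≤ j) :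
    c * j ≤ √(n j : ℝ) := by
  have h1 := mul_sub_le_sqrt_sub_sqrt hc le_rfl hj
  have h2 : 1 ≤ √(n 1 : ℝ) := Real.one_le_sqrt.2 (by exact_mod_cast hpos 1 le_rfl)
  push_cast at h1
  linarith

/-- Factor n_j - n_i = (√n_j - √n_i)(√n_j + √n_i) and drop √n_i from the second factor. -/
theorem mul_sub_mul_sqrt_le (hc0 : 0 < c)
    (hc : ∀ i, 1 ≤ i → c ≤ √(n (i + 1) : ℝ) - √(n i : ℝ)) {i j : ℕ} (hi : 1 ≤ i)
    (hij : i ≤ j) : c * ((j : ℝ) - i) * √(n j : ℝ) ≤ (n j : ℝ) - n i := by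
  have h1 := mul_sub_le_sqrt_sub_sqrt hc hi hij
  have hd : (0 : ℝ) ≤ j - i := sub_nonneg.2 (by exact_mod_cast hij)
  have h0 : 0 ≤ c * ((j : ℝ) - i) := by positivity
  have hu2 : √(n i : ℝ) ^ 2 = n i := Real.sq_sqrt (Nat.cast_nonneg _)
  have hv2 : √(n j : ℝ) ^ 2 = n j := Real.sq_sqrt (Nat.cast_nonneg _)
  have hu0 : 0 ≤ √(n i : ℝ) := Real.sqrt_nonneg _
  have hv0 : 0 ≤ √(n j : ℝ) := Real.sqrt_nonneg _
  nlinarith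

/-- Summing the off-diagonal covariance bounds over a column. -/
theorem sum_offDiagonal_le (hpos : ∀ i, 1 ≤ i → 0 < n i) (hc0 : 0 < c) (hc1 : c ≤ 1)
    (hc : ∀ i, 1 ≤ i → c ≤ √(n (i + 1) : ℝ) - √(n i : ℝ)) (a : ℝ) {j : ℕ} (hj : 1 ≤ j) :
    ∑ i ∈ Finset.Ico 1 j, (1 / (√(n j : ℝ) * √((n j : ℝ) - n i)) + a ^ 2 / n j +
      1 / (√(n i : ℝ) * ((n j : ℝ) - n i))) ≤ (2 / c + a ^ 2 / c + 1 / c ^ 2) / √(n j : ℝ) := by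
  have hj0 : (0 : ℝ) < j := by exact_mod_cast hj
  have hnj : (0 : ℝ) < n j := by exact_mod_cast hpos j hj
  have hr : 0 < √(n j : ℝ) := Real.sqrt_pos.2 hnj
  have hr2 : √(n j : ℝ) ^ 2 = n j := Real.sq_sqrt hnj.le
  have hcj := mul_le_sqrt hpos hc1 hc hj
  set r := √(n j : ℝ) with hrdef
  have hsj : 0 < √(j : ℝ) := Real.sqrt_pos.2 hj0
  -- Linear growth replaces the times by indices: n_j - n_i ≥ c²j(j - i), n_j ≥ cj√n_j, and for the
  -- third term i(j - i) ≥ j - 1. After factoring out 1/√n_j, each sum over i is bounded.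
  have hterm : ∀ i ∈ Finset.Ico 1 j, (1 / (r * √((n j : ℝ) - n i)) + a ^ 2 / n j +
      1 / (√(n i : ℝ) * ((n j : ℝ) - n i))) ≤
      1 / (c * r * √(j : ℝ)) * (1 / √((j : ℝ) - i)) + a ^ 2 / c / r * (1 / j) +
        1 / c ^ 2 / r * (1 / (j - 1)) := by
    intro i hi
    rw [Finset.mem_Ico] at hi
    have hi0 : (1 : ℝ) ≤ i := by exact_mod_cast hi.1
    have hij : (1 : ℝ) ≤ j - i := by
      have : ((i + 1 : ℕ) : ℝ) ≤ j := by exact_mod_cast hi.2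
      push_cast at this; linarith
    have hci := mul_le_sqrt hpos hc1 hc hi.1
    have hdiff := mul_sub_mul_sqrt_le hc0 hc hi.1 hi.2.le
    rw [← hrdef] at hdiff
    have hd0 : 0 < c * ((j : ℝ) - i) * r := by
      have : (0 : ℝ) < j - i := by linarith
      positivity
    refine add_le_add (add_le_add ?_ ?_) ?_
    · have h1 : c * √(j : ℝ) * √((j : ℝ) - i) ≤ √((n j : ℝ) - n i) := by
        refine Real.le_sqrt_of_sq_le ?_
        rw [mul_pow, mul_pow, Real.sq_sqrt hj0.le, Real.sq_sqrt (by linarith)]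
        refine le_trans ?_ hdiff
        have : c * ((j : ℝ) - i) * (c * j) ≤ c * ((j : ℝ) - i) * r := by
          have : 0 ≤ c * ((j : ℝ) - i) := mul_nonneg hc0.le (by linarith)
          gcongr
        linarith
      have h2 : 0 < √((j : ℝ) - i) := Real.sqrt_pos.2 (by linarith)
      have h3 : c * r * √(j : ℝ) * √((j : ℝ) - i) ≤ r * √((n j : ℝ) - n i) := by nlinarith
      rw [← one_div_mul_one_div_rev, mul_comm (1 / √((n j : ℝ) - n i)), one_div_mul_one_div,
        one_div_mul_one_div]
      exact one_div_le_one_div_of_le (by positivity) h3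
    · rw [div_div, div_mul_div_comm, mul_one, ← hr2]
      refine div_le_div_of_nonneg_left (by positivity) (by positivity) ?_
      nlinarith
    · have h1 : (j : ℝ) - 1 ≤ i * (j - i) := by nlinarith
      have hj1 : (0 : ℝ) < j - 1 := by linarith
      have h2 : c ^ 2 * r * (j - 1) ≤ √(n i : ℝ) * ((n j : ℝ) - n i) := by
        calc c ^ 2 * r * (j - 1) ≤ c ^ 2 * r * (i * (j - i)) := by gcongr
          _ = (c * i) * (c * ((j : ℝ) - i) * r) := by ring
          _ ≤ _ := by gcongr
      rw [div_div, one_div_mul_one_div]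
      exact one_div_le_one_div_of_le (by positivity) h2
  refine (Finset.sum_le_sum hterm).trans ?_
  rw [Finset.sum_add_distrib, Finset.sum_add_distrib, ← Finset.mul_sum, Finset.sum_const,
    Finset.sum_const, Nat.card_Ico, nsmul_eq_mul, nsmul_eq_mul, Nat.cast_sub hj, Nat.cast_one,
    add_div, add_div]
  refine add_le_add (add_le_add ?_ ?_) ?_
  · have h1 := sum_Ico_inv_sqrt_sub_le j hj le_rfl
    have h2 : √((j : ℝ) - 1) ≤ √(j : ℝ) := Real.sqrt_le_sqrt (by linarith)
    rw [sub_self, Real.sqrt_zero, sub_zero] at h1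
    calc _ ≤ 1 / (c * r * √(j : ℝ)) * (2 * √(j : ℝ)) := by gcongr; linarith
      _ = _ := by field_simp
  · have : ((j : ℝ) - 1) * (1 / j) ≤ 1 := by
      rw [mul_one_div, div_le_one hj0]; linarith
    have h0 : 0 ≤ a ^ 2 / c / r := by positivity
    nlinarith
  -- For j = 1 the quotient is 0 / 0 = 0, which `div_self_le_one` covers.
  · have : ((j : ℝ) - 1) * (1 / (j - 1)) ≤ 1 := by
      rw [mul_one_div]; exact div_self_le_one _
    have h0 : 0 ≤ 1 / c ^ 2 / r := by positivity
    nlinarith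

end Growth

/-! ### Second moment of the hit count. -/

section RandomWalk

variable {Ω : Type*} [MeasurableSpace Ω] {P : Measure Ω} [IsProbabilityMeasure P]
  {X : ℕ → Ω → ℝ} {h b σ : ℝ}

theorem memLp_centredHit (hmeas : ∀ i, AEMeasurable (X i) P) (a : ℝ) (n : ℕ) :
    MemLp (centredHit X h b σ a n) 2 P := by
  have hN := nullMeasurableSet_hitEvent (h := h) (b := b) hmeas (a * σ) n
  have h1 : Integrable ((hitEvent X h b (a * σ) n).indicator fun _ => (1 : ℝ)) P :=
    (integrable_const (1 : ℝ)).indicator₀ hN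
  have h2 : MemLp ((hitEvent X h b (a * σ) n).indicator fun _ => (1 : ℝ)) 2 P :=
    MemLp.of_bound h1.aestronglyMeasurable 1 (ae_of_all _ fun ω => by
      by_cases hω : ω ∈ hitEvent X h b (a * σ) n <;> simp [hω])
  exact h2.sub (memLp_const _)

/-- Second moment of the centred number of hits. -/
theorem HasLocalLimit.exists_integral_sq_sum_centredHit_le {C : ℝ}
    (hL : HasLocalLimit P X h b σ C)
    (hC : 0 < C) (hindep : iIndepFun X P) (hmeas : ∀ i, AEMeasurable (X i) P) (hh : 0 < h)
    (hσ : 0 < σ) {n : ℕ → ℕ} (hpos : ∀ i, 1 ≤ i → 0 < n i) {A : ℝ} (hA : 0 < A)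
    (hgap : ∀ i, 1 ≤ i → A * √(n i : ℝ) ≤ (n (i + 1) : ℝ) - n i) (N : ℝ) :
    ∃ K, 0 < K ∧ ∀ a : ℝ, |a| ≤ N → ∀ m : ℕ,
      ∫ ω, (∑ i ∈ Finset.Icc 1 m, centredHit X h b σ a (n i) ω) ^ 2 ∂P ≤
        K * ∑ i ∈ Finset.Icc 1 m, 1 / √(n i : ℝ) := by
  obtain ⟨K, hK, hoff, hdiag⟩ := hL.exists_integral_centredHit_mul_le hC hindep hmeas hh hσ
  obtain ⟨c, hc0, hc1, hc⟩ := exists_le_sqrt_sub_sqrt hpos hA hgap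
  refine ⟨2 * (K * (2 / c + N ^ 2 / c + 1 / c ^ 2)) + K, by positivity, fun a ha m => ?_⟩
  have ha2 : a ^ 2 ≤ N ^ 2 := by
    rw [← sq_abs a]; gcongr
  have hLp := fun i => memLp_centredHit (P := P) (h := h) (b := b) (σ := σ) hmeas a (n i)
  -- Passing from m to m + 1 adds twice one column of mixed moments and one diagonal term, each O(1
  -- / √n_{m+1}); this explains the two summands of the constant.
  induction m with
  | zero => simp
  | succ m ih =>
    rw [Finset.sum_Icc_succ_top (by omega), mul_add]
    simp_rw [Finset.sum_Icc_succ_top (show 1 ≤ m + 1 by omega)]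
    have hT : MemLp (fun ω => ∑ i ∈ Finset.Icc 1 m, centredHit X h b σ a (n i) ω) 2 P :=
      memLp_finsetSum _ fun i _ => hLp i
    have hZ := hLp (m + 1)
    have i1 := hT.integrable_sq
    have i2 := hZ.integrable_sq
    have i3 : Integrable (fun ω => (∑ i ∈ Finset.Icc 1 m, centredHit X h b σ a (n i) ω) *
      centredHit X h b σ a (n (m + 1)) ω) P := hT.integrable_mul hZ
    have e : ∀ ω, (∑ i ∈ Finset.Icc 1 m, centredHit X h b σ a (n i) ω +
        centredHit X h b σ a (n (m + 1)) ω) ^ 2 =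
        (∑ i ∈ Finset.Icc 1 m, centredHit X h b σ a (n i) ω) ^ 2 +
        (2 * ((∑ i ∈ Finset.Icc 1 m, centredHit X h b σ a (n i) ω) *
          centredHit X h b σ a (n (m + 1)) ω) + centredHit X h b σ a (n (m + 1)) ω ^ 2) := by
      intro ω; ring
    simp_rw [e]
    have i23 : Integrable (fun ω => 2 * ((∑ i ∈ Finset.Icc 1 m, centredHit X h b σ a (n i) ω) *
      centredHit X h b σ a (n (m + 1)) ω) + centredHit X h b σ a (n (m + 1)) ω ^ 2) P :=
      (i3.const_mul 2).add i2
    rw [integral_add i1 i23, integral_add (i3.const_mul 2) i2,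
      integral_const_mul]
    refine add_le_add ih ?_
    have hcross : ∫ ω, (∑ i ∈ Finset.Icc 1 m, centredHit X h b σ a (n i) ω) *
        centredHit X h b σ a (n (m + 1)) ω ∂P ≤
        K * (2 / c + N ^ 2 / c + 1 / c ^ 2) * (1 / √(n (m + 1) : ℝ)) := by
      simp_rw [Finset.sum_mul]
      have ip : ∀ i, Integrable (fun ω => centredHit X h b σ a (n i) ω *
          centredHit X h b σ a (n (m + 1)) ω) P := fun i => (hLp i).integrable_mul (hLp (m + 1))
      rw [integral_finsetSum _ fun i _ => ip i]
      have hIco : Finset.Icc 1 m = Finset.Ico 1 (m + 1) := rfl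
      rw [hIco]
      have hs : ∀ i ∈ Finset.Ico 1 (m + 1), ∫ ω, centredHit X h b σ a (n i) ω *
          centredHit X h b σ a (n (m + 1)) ω ∂P ≤ K * (1 / (√(n (m + 1) : ℝ) *
            √((n (m + 1) : ℝ) - n i)) + a ^ 2 / n (m + 1) +
            1 / (√(n i : ℝ) * ((n (m + 1) : ℝ) - n i))) := by
        intro i hi
        rw [Finset.mem_Ico] at hi
        refine hoff a (n i) (n (m + 1)) (hpos i hi.1) ?_
        have h1 := mul_sub_mul_sqrt_le hc0 hc hi.1 hi.2.le
        have h2 : (0 : ℝ) < (m + 1 : ℕ) - i := sub_pos.2 (by exact_mod_cast hi.2)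
        have h3 : 0 < √(n (m + 1) : ℝ) :=
          Real.sqrt_pos.2 (by exact_mod_cast hpos (m + 1) (by omega))
        have h4 : (n i : ℝ) < n (m + 1) := by
          have : 0 < c * (((m + 1 : ℕ) : ℝ) - i) * √(n (m + 1) : ℝ) := by positivity
          linarith
        exact_mod_cast h4
      refine (Finset.sum_le_sum hs).trans ?_
      rw [← Finset.mul_sum, mul_assoc, mul_one_div]
      refine mul_le_mul_of_nonneg_left ?_ hK.le
      refine (sum_offDiagonal_le hpos hc0 hc1 hc a (by omega)).trans ?_
      gcongr
    have hd := hdiag a (n (m + 1)) (hpos (m + 1) (by omega))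
    rw [add_mul, mul_one_div K]
    linarith

end RandomWalk

/-! ### From tail bounds to almost sure convergence. -/

/-- Chebyshev's inequality with a strict inequality in the event. -/
theorem measure_lt_abs_le_of_integral_sq_le {Ω : Type*} [MeasurableSpace Ω] {P : Measure Ω}
    [IsProbabilityMeasure P] {T : Ω → ℝ} (hT : MemLp T 2 P) {B δ : ℝ}
    (hB : ∫ ω, T ω ^ 2 ∂P ≤ B) (hδ : 0 < δ) :
    P {ω | δ < |T ω|} ≤ ENNReal.ofReal (B / δ ^ 2) := by
  have h1 := mul_meas_ge_le_integral_of_nonneg (μ := P)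
    (ae_of_all _ fun ω => sq_nonneg (T ω)) hT.integrable_sq (δ ^ 2)
  have h2 : P.real {ω | δ < |T ω|} ≤ P.real {ω | δ ^ 2 ≤ T ω ^ 2} := by
    refine measureReal_mono fun ω hω => ?_
    have hω' : δ < |T ω| := hω
    change δ ^ 2 ≤ T ω ^ 2
    rw [← sq_abs (T ω)]
    gcongr
  rw [← ofReal_measureReal]
  refine ENNReal.ofReal_le_ofReal ?_
  rw [le_div_iff₀ (by positivity)]
  nlinarith [mul_le_mul_of_nonneg_right h2 (sq_nonneg δ)]

/-- Interpolation along a subsequence on which the normalisation is close to `k ^ 2`. -/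
theorem tendsto_div_of_tendsto_subseq {u M : ℕ → ℝ} {l : ℝ} {φ : ℕ → ℕ} (hu : Monotone u)
    (hu0 : ∀ m, 0 ≤ u m) (hM : Monotone M) (hMtop : Tendsto M atTop atTop)
    (hφ1 : ∀ k : ℕ, (k : ℝ) ^ 2 ≤ M (φ k)) (hφ2 : ∀ k, M (φ k) ≤ (k : ℝ) ^ 2 + 1)
    (hφ3 : ∀ (k m : ℕ), (k : ℝ) ^ 2 ≤ M m → φ k ≤ m)
    (hlim : Tendsto (fun k => u (φ k) / M (φ k)) atTop (𝓝 l)) :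
    Tendsto (fun m => u m / M m) atTop (𝓝 l) := by
  -- With κ² ≤ M_m < (κ + 1)² one has φ κ ≤ m ≤ φ (κ + 1), so monotonicity of u squeezes the ratio
  -- between subsequence ratios times factors tending to one.
  set κ : ℕ → ℕ := fun m => ⌊√(M m)⌋₊ with hκ
  have hκtop : Tendsto κ atTop atTop :=
    tendsto_nat_floor_atTop.comp (Real.tendsto_sqrt_atTop.comp hMtop)
  have hinv : Tendsto (fun k : ℕ => 1 / (k : ℝ)) atTop (𝓝 0) :=
    tendsto_one_div_atTop_nhds_zero_nat
  have hinv1 : Tendsto (fun k : ℕ => 1 / ((k : ℝ) + 1)) atTop (𝓝 0) :=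
    tendsto_one_div_add_atTop_nhds_zero_nat
  have hlow : Tendsto (fun k : ℕ => u (φ k) / M (φ k) * (1 - 1 / ((k : ℝ) + 1)) ^ 2) atTop
      (𝓝 l) := by
    have := hlim.mul ((tendsto_const_nhds (x := (1 : ℝ)).sub hinv1).pow 2)
    simpa using this
  have hup : Tendsto (fun k : ℕ => u (φ (k + 1)) / M (φ (k + 1)) *
      ((1 + 1 / (k : ℝ)) ^ 2 + (1 / (k : ℝ)) ^ 2)) atTop (𝓝 l) := by
    have := (hlim.comp (tendsto_add_atTop_nat 1)).mul
      (((tendsto_const_nhds (x := (1 : ℝ)).add hinv).pow 2).add (hinv.pow 2))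
    simpa using this
  refine tendsto_of_tendsto_of_tendsto_of_le_of_le' (hlow.comp hκtop) (hup.comp hκtop) ?_ ?_
  · filter_upwards [hMtop.eventually_ge_atTop 1, hκtop.eventually_ge_atTop 1] with m hm hk
    have hk' : (1 : ℝ) ≤ κ m := by exact_mod_cast hk
    have h1 : (κ m : ℝ) ≤ √(M m) := Nat.floor_le (Real.sqrt_nonneg _)
    have h2 : √(M m) < κ m + 1 := Nat.lt_floor_add_one _
    have hs : √(M m) ^ 2 = M m := Real.sq_sqrt (by linarith)
    have h3 : (κ m : ℝ) ^ 2 ≤ M m := by rw [← hs]; gcongr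
    have h4 : M m ≤ ((κ m : ℝ) + 1) ^ 2 := by rw [← hs]; gcongr
    have h5 : u (φ (κ m)) ≤ u m := hu (hφ3 _ _ h3)
    have h6 := hφ1 (κ m)
    have hMφ : 0 < M (φ (κ m)) := by nlinarith
    have hu' := hu0 (φ (κ m))
    simp only [Function.comp_apply]
    have e : 1 - 1 / ((κ m : ℝ) + 1) = κ m / (κ m + 1) := by
      have : (κ m : ℝ) + 1 ≠ 0 := by positivity
      field_simp; ring
    rw [e, div_pow]
    calc u (φ (κ m)) / M (φ (κ m)) * ((κ m : ℝ) ^ 2 / ((κ m : ℝ) + 1) ^ 2)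
        ≤ u (φ (κ m)) / M (φ (κ m)) * (M (φ (κ m)) / ((κ m : ℝ) + 1) ^ 2) := by gcongr
      _ = u (φ (κ m)) / ((κ m : ℝ) + 1) ^ 2 := by field_simp
      _ ≤ u (φ (κ m)) / M m := by gcongr
      _ ≤ u m / M m := by gcongr
  · filter_upwards [hMtop.eventually_ge_atTop 1, hκtop.eventually_ge_atTop 1] with m hm hk
    have hk' : (1 : ℝ) ≤ κ m := by exact_mod_cast hk
    have h1 : (κ m : ℝ) ≤ √(M m) := Nat.floor_le (Real.sqrt_nonneg _)
    have h2 : √(M m) < κ m + 1 := Nat.lt_floor_add_one _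
    have hs : √(M m) ^ 2 = M m := Real.sq_sqrt (by linarith)
    have h3 : (κ m : ℝ) ^ 2 ≤ M m := by rw [← hs]; gcongr
    have h4 : M m < ((κ m : ℝ) + 1) ^ 2 := by rw [← hs]; gcongr
    have h6 := hφ1 (κ m + 1)
    have h7 := hφ2 (κ m + 1)
    push_cast at h6 h7
    have h5 : m ≤ φ (κ m + 1) := by
      by_contra hcon
      push Not at hcon
      have := hM hcon.le
      linarith
    have hMφ : 0 < M (φ (κ m + 1)) := by nlinarith
    have hu' := hu0 (φ (κ m + 1))
    have hu'' := hu0 m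
    simp only [Function.comp_apply]
    have e : (1 + 1 / (κ m : ℝ)) ^ 2 + (1 / (κ m : ℝ)) ^ 2
        = (((κ m : ℝ) + 1) ^ 2 + 1) / (κ m : ℝ) ^ 2 := by
      have : (κ m : ℝ) ≠ 0 := by positivity
      field_simp
    rw [e]
    calc u m / M m ≤ u (φ (κ m + 1)) / M m := by gcongr; exact hu h5
      _ ≤ u (φ (κ m + 1)) / (κ m : ℝ) ^ 2 := by gcongr
      _ = u (φ (κ m + 1)) / M (φ (κ m + 1)) * (M (φ (κ m + 1)) / (κ m : ℝ) ^ 2) := by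
        field_simp
      _ ≤ _ := by gcongr

/-- Almost sure convergence of monotone sums from a tail bound of the order of the inverse of
the normalisation. -/
theorem ae_tendsto_div_of_measure_le {Ω : Type*} [MeasurableSpace Ω] {P : Measure Ω}
    {U : ℕ → Ω → ℝ} {M : ℕ → ℝ} {l : ℝ} (hU : ∀ ω, Monotone fun m => U m ω)
    (hU0 : ∀ m ω, 0 ≤ U m ω) (hM : Monotone M) (hM0 : M 0 = 0)
    (hstep : ∀ m, M (m + 1) ≤ M m + 1) (hMtop : Tendsto M atTop atTop)
    (htail : ∀ ε, 0 < ε → ∃ C, 0 < C ∧ ∀ m, 0 < M m →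
      P {ω | ε < |U m ω / M m - l|} ≤ ENNReal.ofReal (C / M m)) :
    ∀ᵐ ω ∂P, Tendsto (fun m => U m ω / M m) atTop (𝓝 l) := by
  classical
  have hex : ∀ k : ℕ, ∃ m, (k : ℝ) ^ 2 ≤ M m := fun k =>
    (hMtop.eventually_ge_atTop ((k : ℝ) ^ 2)).exists
  -- The first index at which M reaches k²; as M grows by at most one per step, it overshoots by at
  -- most one.
  set φ : ℕ → ℕ := fun k => Nat.find (hex k) with hφ
  have hφ1 : ∀ k : ℕ, (k : ℝ) ^ 2 ≤ M (φ k) := fun k => Nat.find_spec (hex k)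
  have hφ3 : ∀ (k m : ℕ), (k : ℝ) ^ 2 ≤ M m → φ k ≤ m := fun k m h => Nat.find_min' (hex k) h
  have hφ2 : ∀ k, M (φ k) ≤ (k : ℝ) ^ 2 + 1 := by
    intro k
    rcases Nat.eq_zero_or_pos (φ k) with h0 | h0
    · rw [h0, hM0]; positivity
    · obtain ⟨p, hp⟩ : ∃ p, φ k = p + 1 := ⟨φ k - 1, by omega⟩
      have h1 : ¬ (k : ℝ) ^ 2 ≤ M p := Nat.find_min (hex k) (show p < φ k by omega)
      push Not at h1
      rw [hp]
      linarith [hstep p]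
  -- Borel–Cantelli for countably many tolerances 1/(j + 1). The shift to k + 1 avoids k = 0, where
  -- M may vanish.
  have hbc : ∀ j : ℕ, ∀ᵐ ω ∂P, ∀ᶠ k in atTop,
      |U (φ (k + 1)) ω / M (φ (k + 1)) - l| ≤ 1 / ((j : ℝ) + 1) := by
    intro j
    obtain ⟨C, hC, htl⟩ := htail (1 / ((j : ℝ) + 1)) (by positivity)
    have hle : ∀ k : ℕ, P {ω | 1 / ((j : ℝ) + 1) < |U (φ (k + 1)) ω / M (φ (k + 1)) - l|}
        ≤ ENNReal.ofReal (C * (((k + 1 : ℕ) : ℝ) ^ 2)⁻¹) := by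
      intro k
      have h1 := hφ1 (k + 1)
      have h2 : (0 : ℝ) < ((k + 1 : ℕ) : ℝ) ^ 2 := by positivity
      refine (htl _ (h2.trans_le h1)).trans (ENNReal.ofReal_le_ofReal ?_)
      rw [← div_eq_mul_inv]
      gcongr
    have hsum : Summable fun k : ℕ => C * (((k + 1 : ℕ) : ℝ) ^ 2)⁻¹ :=
      ((summable_nat_add_iff 1).2 (Real.summable_nat_pow_inv.2 one_lt_two)).mul_left C
    have := ae_eventually_notMem (ne_top_of_le_ne_top hsum.tsum_ofReal_ne_top
      (ENNReal.tsum_le_tsum hle))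
    filter_upwards [this] with ω hω
    filter_upwards [hω] with k hk
    exact not_lt.1 hk
  filter_upwards [ae_all_iff.2 hbc] with ω hω
  refine tendsto_div_of_tendsto_subseq (hU ω) (fun m => hU0 m ω) hM hMtop hφ1 hφ2 hφ3 ?_
  refine (tendsto_add_atTop_iff_nat 1).1 ?_
  rw [Metric.tendsto_atTop]
  intro ε hε
  obtain ⟨j, hj⟩ := exists_nat_one_div_lt hε
  obtain ⟨k₀, hk₀⟩ := eventually_atTop.1 (hω j)
  exact ⟨k₀, fun k hk => by rw [Real.dist_eq]; exact (hk₀ k hk).trans_lt hj⟩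

/-! ### Lower bound for the normalisation. -/

/-- Because log 16 = 4 log 2 exceeds e; this makes the triple logarithm positive from 16 on. -/
theorem one_lt_log_log_sixteen : 1 < Real.log (Real.log 16) := by
  have h16 : Real.log 16 = 4 * Real.log 2 := by
    rw [show (16 : ℝ) = 2 ^ 4 by norm_num, Real.log_pow]; norm_num
  have h1 := Real.log_two_gt_d9
  have h2 := Real.exp_one_lt_d9
  rw [Real.lt_log_iff_exp_lt (by rw [h16]; linarith), h16]
  linarith

theorem one_lt_log_log {m : ℕ} (hm : 16 ≤ m) : 1 < Real.log (Real.log m) := by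
  refine one_lt_log_log_sixteen.trans_le ?_
  have h16 : (16 : ℝ) ≤ m := by exact_mod_cast hm
  have : 0 < Real.log 16 := Real.log_pos (by norm_num)
  gcongr

theorem log_sub_log_le_sum_inv {m : ℕ} (hm : 16 ≤ m) :
    Real.log (m + 1) - Real.log 16 ≤ ∑ i ∈ Finset.Icc 16 m, 1 / (i : ℝ) := by
  have hstep : ∀ x : ℝ, 0 < x → Real.log (x + 1) - Real.log x ≤ 1 / x := by
    intro x hx
    rw [← Real.log_div (by linarith) hx.ne']
    refine (Real.log_le_sub_one_of_pos (by positivity)).trans (le_of_eq ?_)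
    field_simp
    ring
  induction m, hm using Nat.le_induction with
  | base =>
    have := hstep 16 (by norm_num)
    simpa using this
  | succ m hm ih =>
    rw [Finset.sum_Icc_succ_top (by omega)]
    have := hstep (m + 1) (by positivity)
    push_cast
    linarith

/-- Lower bound for the normalisation under the growth condition. -/
theorem exists_mul_sqrt_log_le_sum {n : ℕ → ℕ} (hpos : ∀ i, 1 ≤ i → 0 < n i) {A γ : ℝ}
    (hA : 0 < A) (hγ : 0 < γ)
    (hgrow : ∀ i : ℕ, 16 ≤ i →
        (n i : ℝ) ≤ A⁻¹ * (i : ℝ) ^ 2 * Real.log i * Real.log (Real.log i) ^ (-3 : ℝ) *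
          Real.log (Real.log (Real.log i)) ^ (-2 * γ)) :
    ∃ c, 0 < c ∧ ∀ m : ℕ, 16 ≤ m →
      c * √(Real.log m) ≤ ∑ i ∈ Finset.Icc 1 m, 1 / √(n i : ℝ) := by
  set δ := Real.log (Real.log (Real.log 16)) with hδ
  have hδ0 : 0 < δ := Real.log_pos one_lt_log_log_sixteen
  set B := A⁻¹ * δ ^ (-2 * γ) with hB
  have hB0 : 0 < B := by positivity
  have h16 : 0 < Real.log 16 := Real.log_pos (by norm_num)
  -- Both iterated-logarithm factors have negative exponents and bases bounded below for i ≥ 16, so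
  -- they are absorbed into B.
  have hn : ∀ i : ℕ, 16 ≤ i → (n i : ℝ) ≤ B * (i : ℝ) ^ 2 * Real.log i := by
    intro i hi
    have hi' : (16 : ℝ) ≤ i := by exact_mod_cast hi
    have hl1 : 0 < Real.log i := Real.log_pos (by linarith)
    have hl2 := one_lt_log_log hi
    have hl3 : δ ≤ Real.log (Real.log (Real.log i)) := by
      have := one_lt_log_log_sixteen
      rw [hδ]
      gcongr
    have e1 : Real.log (Real.log i) ^ (-3 : ℝ) ≤ 1 :=
      Real.rpow_le_one_of_one_le_of_nonpos hl2.le (by norm_num)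
    have e2 : Real.log (Real.log (Real.log i)) ^ (-2 * γ) ≤ δ ^ (-2 * γ) :=
      Real.rpow_le_rpow_of_nonpos hδ0 hl3 (by linarith)
    refine (hgrow i hi).trans ?_
    calc _ ≤ A⁻¹ * (i : ℝ) ^ 2 * Real.log i * 1 * δ ^ (-2 * γ) := by
          have : 0 ≤ Real.log (Real.log (Real.log i)) ^ (-2 * γ) :=
            Real.rpow_nonneg (hδ0.le.trans hl3) _
          gcongr
      _ = _ := by rw [hB]; ring
  refine ⟨1 / (√B * (1 + 16 * Real.log 16)), by positivity, fun m hm => ?_⟩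
  have hm' : (16 : ℝ) ≤ m := by exact_mod_cast hm
  have hl1 : 0 < Real.log m := Real.log_pos (by linarith)
  have hsl : 0 < √(Real.log m) := Real.sqrt_pos.2 hl1
  have hsB : 0 < √B := Real.sqrt_pos.2 hB0
  set S := ∑ i ∈ Finset.Icc 16 m, 1 / (i : ℝ) with hS
  -- Replacing log i by log m leaves a harmonic sum of order log m divided by √(log m).
  have hterm : ∀ i ∈ Finset.Icc 16 m, 1 / (√B * √(Real.log m)) * (1 / (i : ℝ))
      ≤ 1 / √(n i : ℝ) := by
    intro i hi
    rw [Finset.mem_Icc] at hi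
    have hi' : (16 : ℝ) ≤ i := by exact_mod_cast hi.1
    have hni : (0 : ℝ) < n i := by exact_mod_cast hpos i (by omega)
    have him : (i : ℝ) ≤ m := by exact_mod_cast hi.2
    rw [one_div_mul_one_div]
    refine one_div_le_one_div_of_le (Real.sqrt_pos.2 hni) ?_
    refine Real.sqrt_le_iff.2 ⟨by positivity, ?_⟩
    rw [mul_pow, mul_pow, Real.sq_sqrt hB0.le, Real.sq_sqrt hl1.le]
    calc (n i : ℝ) ≤ B * (i : ℝ) ^ 2 * Real.log i := hn i hi.1
      _ ≤ B * (i : ℝ) ^ 2 * Real.log m := by gcongr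
      _ = _ := by ring
  have hsum : 1 / (√B * √(Real.log m)) * S ≤ ∑ i ∈ Finset.Icc 1 m, 1 / √(n i : ℝ) := by
    rw [hS, Finset.mul_sum]
    refine (Finset.sum_le_sum hterm).trans ?_
    refine Finset.sum_le_sum_of_subset_of_nonneg
      (Finset.Icc_subset_Icc_left (by norm_num)) fun i _ _ => by positivity
  refine le_trans ?_ hsum
  have hS1 : Real.log m - Real.log 16 ≤ S := by
    have := log_sub_log_le_sum_inv hm
    have h2 : Real.log m ≤ Real.log (m + 1) := by gcongr; linarith
    linarith
  have hS2 : 1 / 16 ≤ S := by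
    have := Finset.single_le_sum (f := fun i : ℕ => 1 / (i : ℝ))
      (fun i _ => by positivity) (Finset.mem_Icc.2 ⟨le_rfl, hm⟩)
    simpa [hS] using this
  -- Since S ≥ 1/16, the constant log 16 is at most 16 (log 16) S.
  have hS3 : Real.log m ≤ (1 + 16 * Real.log 16) * S := by nlinarith
  have hs2 : √(Real.log m) * √(Real.log m) = Real.log m := Real.mul_self_sqrt hl1.le
  rw [div_mul_eq_mul_div, one_mul, div_mul_eq_mul_div, one_mul, div_le_div_iff₀ (by positivity)
    (by positivity)]
  calc √(Real.log m) * (√B * √(Real.log m)) = √B * Real.log m := by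
        rw [mul_left_comm, hs2]
    _ ≤ √B * ((1 + 16 * Real.log 16) * S) := by gcongr
    _ = _ := by ring

/-- With y = log log m, the left side is at most y^{1+γ} and √(log m) = e^{y/2}; the constant comes
from x ≤ e^x at x = y / (2(1 + γ)). -/
theorem exists_log_log_mul_rpow_le {γ : ℝ} (hγ : 0 < γ) :
    ∃ C, 0 < C ∧ ∀ m : ℕ, 16 ≤ m →
      Real.log (Real.log m) * Real.log (Real.log (Real.log m)) ^ γ ≤ C * √(Real.log m) := by
  refine ⟨(2 * (1 + γ)) ^ (1 + γ), by positivity, fun m hm => ?_⟩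
  have hm' : (16 : ℝ) ≤ m := by exact_mod_cast hm
  have hl1 : 0 < Real.log m := Real.log_pos (by linarith)
  have hl2 := one_lt_log_log hm
  set y := Real.log (Real.log m) with hy
  have hy0 : 0 < y := by linarith
  have h1 : Real.log y ^ γ ≤ y ^ γ :=
    Real.rpow_le_rpow (Real.log_nonneg hl2.le) (Real.log_le_self hy0.le) hγ.le
  have h2 : y * y ^ γ = y ^ (1 + γ) := by rw [Real.rpow_add hy0, Real.rpow_one]
  have h3 : y ^ (1 + γ) = (2 * (1 + γ)) ^ (1 + γ) * (y / (2 * (1 + γ))) ^ (1 + γ) := by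
    rw [← Real.mul_rpow (by positivity) (by positivity)]
    congr 1
    field_simp
  have h4 : (y / (2 * (1 + γ))) ^ (1 + γ) ≤ √(Real.log m) := by
    have h5 : y / (2 * (1 + γ)) ≤ Real.exp (y / (2 * (1 + γ))) := by
      linarith [Real.add_one_le_exp (y / (2 * (1 + γ)))]
    refine (Real.rpow_le_rpow (by positivity) h5 (by positivity)).trans (le_of_eq ?_)
    rw [← Real.exp_mul, Real.sqrt_eq_rpow, Real.rpow_def_of_pos hl1, ← hy]
    congr 1
    field_simp
  calc y * Real.log y ^ γ ≤ y * y ^ γ := by gcongr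
    _ = _ := by rw [h2, h3]
    _ ≤ _ := by gcongr

/-! ### Assembly of both statements. -/

theorem natCast_rpow_neg_half (k : ℕ) : (k : ℝ) ^ (-(1 / 2) : ℝ) = 1 / √(k : ℝ) := by
  rw [Real.rpow_neg (Nat.cast_nonneg k), ← Real.sqrt_eq_rpow, one_div]

/-- Relative deviations divide by ℓ_a, so uniformity over [-N, N] needs its least value, attained at
the endpoint. -/
theorem hitLimit_le_hitLimit {h σ a N : ℝ} (hh : 0 < h) (hσ : 0 < σ) (ha : |a| ≤ N) :
    hitLimit h σ N ≤ hitLimit h σ a := by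
  have : a ^ 2 ≤ N ^ 2 := by rw [← sq_abs a]; gcongr
  rw [hitLimit, hitLimit]
  gcongr

theorem hitQuotient_sub_eq {Ω : Type*} {X : ℕ → Ω → ℝ} {h b σ : ℝ} {n : ℕ → ℕ}
    {m : ℕ} (hM : 0 < ∑ i ∈ Finset.Icc 1 m, 1 / √(n i : ℝ))
    (a : ℝ) (ω : Ω) :
    hitQuotient X h b σ n a m ω - hitLimit h σ a =
      (∑ i ∈ Finset.Icc 1 m, centredHit X h b σ a (n i) ω) /
        ∑ i ∈ Finset.Icc 1 m, 1 / √(n i : ℝ) := by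
  simp only [hitQuotient, natCast_rpow_neg_half, centredHit, Finset.sum_sub_distrib]
  rw [sub_div]
  congr 1
  rw [eq_div_iff hM.ne', Finset.mul_sum]
  exact Finset.sum_congr rfl fun i _ => mul_one_div _ _

/-- First Borel–Cantelli with hitting probabilities O(1 / √n_i). Indices are shifted by one because
nothing is assumed about `n 0`. -/
theorem HasLocalLimit.measure_frequently_hitEvent_eq_zero {Ω : Type*} [MeasurableSpace Ω]
    {P : Measure Ω} [IsProbabilityMeasure P] {X : ℕ → Ω → ℝ} {h b σ C : ℝ}
    (hL : HasLocalLimit P X h b σ C) (hC : 0 < C) (hh : 0 < h) (hσ : 0 < σ) {n : ℕ → ℕ}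
    (hpos : ∀ i, 1 ≤ i → 0 < n i)
    (hsum : Summable fun i : ℕ => (n i : ℝ) ^ (-(1 / 2) : ℝ)) (a : ℝ) :
    P {ω | ∃ᶠ i in atTop, ω ∈ hitEvent X h b a (n i)} = 0 := by
  have hsum' := ((summable_nat_add_iff 1).2 hsum).mul_left (C + h / (√(2 * Real.pi) * σ))
  have hle : ∀ i : ℕ, P (hitEvent X h b a (n (i + 1))) ≤ ENNReal.ofReal
      ((C + h / (√(2 * Real.pi) * σ)) * (n (i + 1) : ℝ) ^ (-(1 / 2) : ℝ)) := by
    intro i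
    rw [← ofReal_measureReal, natCast_rpow_neg_half, mul_one_div]
    exact ENNReal.ofReal_le_ofReal (hL.hitEvent_le hC hh hσ a (hpos _ (by omega)))
  have hae := ae_eventually_notMem (ne_top_of_le_ne_top hsum'.tsum_ofReal_ne_top
    (ENNReal.tsum_le_tsum hle))
  have hae' : ∀ᵐ ω ∂P, ¬ ∃ᶠ i in atTop, ω ∈ hitEvent X h b a (n i) := by
    filter_upwards [hae] with ω hω
    rw [not_frequently]
    rw [eventually_atTop] at hω ⊢
    obtain ⟨i₀, hi₀⟩ := hω
    refine ⟨i₀ + 1, fun i hi => ?_⟩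
    have := hi₀ (i - 1) (by omega)
    rwa [show i - 1 + 1 = i by omega] at this
  simpa only [ae_iff, not_not] using hae'

theorem mainTheorem2 {Ω : Type*} [MeasurableSpace Ω] (P : Measure Ω) [IsProbabilityMeasure P]
    (X : ℕ → Ω → ℝ) (h b σ : ℝ)
    (hindep : iIndepFun X P)
    (hident : ∀ i, IdentDistrib (X i) (X 0) P P)
    (hlattice : ∀ i, IsLatticeValued P (X i) h b)
    (hthird : Integrable (fun ω => |X 0 ω| ^ 3) P)
    (hmean : ∫ ω, X 0 ω ∂P = 0)
    (hσ : 0 < σ)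
    (hvar : ∫ ω, X 0 ω ^ 2 ∂P = σ ^ 2)
    -- the sequence `n 1 ≤ n 2 ≤ …` of positive integers; the value `n 0` plays no role
    (n : ℕ → ℕ)
    (hpos : ∀ i, 1 ≤ i → 0 < n i)
    (hmono : MonotoneOn n (Set.Ici 1)) :
    -- (a)
    (Summable (fun i : ℕ => (n i : ℝ) ^ (-(1 / 2) : ℝ)) →
      ∀ a : ℝ, P {ω | ∃ᶠ i in atTop, ω ∈ hitEvent X h b a (n i)} = 0) ∧
    -- (b); for integers `i ≥ 3`, `log log log i` is defined and positive exactly when `i ≥ 16`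
    (∀ A γ : ℝ, 0 < A → 1 < γ →
      (∀ i, 1 ≤ i → A * (n i : ℝ) ^ (1 / 2 : ℝ) ≤ (n (i + 1) : ℝ) - (n i : ℝ)) →
      (∀ i : ℕ, 16 ≤ i →
        (n i : ℝ) ≤ A⁻¹ * (i : ℝ) ^ 2 * Real.log i * Real.log (Real.log i) ^ (-3 : ℝ) *
          Real.log (Real.log (Real.log i)) ^ (-2 * γ)) →
      (∀ a : ℝ, ∀ᵐ ω ∂P,
        Tendsto (fun m : ℕ => hitQuotient X h b σ n a m ω) atTop (𝓝 (hitLimit h σ a))) ∧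
      (∀ N : ℝ, 0 < N → ∃ C : ℝ, 0 < C ∧ ∀ ε : ℝ, 0 < ε → ∀ m : ℕ, 16 ≤ m →
        (⨆ a ∈ Set.Icc (-N) N,
            P {ω | ε < |hitQuotient X h b σ n a m ω / hitLimit h σ a - 1|}) ≤
          ENNReal.ofReal (C * ε ^ (-2 : ℝ) * (Real.log (Real.log m))⁻¹ *
            Real.log (Real.log (Real.log m)) ^ (-γ)))) := by
  have hmeas : ∀ i, AEMeasurable (X i) P := fun i => (hident i).aemeasurable_fst
  have hh : 0 < h := (hlattice 0).pos
  obtain ⟨C₀, hC₀, hL⟩ := exists_local_limit hindep hident hlattice hthird hmean hσ hvar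
  replace hL : HasLocalLimit P X h b σ C₀ := hL
  refine ⟨hL.measure_frequently_hitEvent_eq_zero hC₀ hh hσ hpos,
    fun A γ hA hγ hgap hgrow => ?_⟩
  have hgap' : ∀ i, 1 ≤ i → A * √(n i : ℝ) ≤ (n (i + 1) : ℝ) - n i := fun i hi => by
    rw [Real.sqrt_eq_rpow]; exact hgap i hi
  have hγ0 : 0 < γ := by linarith
  obtain ⟨c, hc, hlow⟩ := exists_mul_sqrt_log_le_sum hpos hA hγ0 hgrow
  set M : ℕ → ℝ := fun m => ∑ i ∈ Finset.Icc 1 m, 1 / √(n i : ℝ) with hMdef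
  have hMpos : ∀ m, 1 ≤ m → 0 < M m := fun m hm =>
    Finset.sum_pos (fun i hi => by
      have : (0 : ℝ) < n i := by exact_mod_cast hpos i (Finset.mem_Icc.1 hi).1
      positivity) ⟨1, Finset.mem_Icc.2 ⟨le_rfl, hm⟩⟩
  -- This Chebyshev bound, uniform in |a| ≤ N, feeds both the almost sure limit (with N = |a|) and
  -- the rate.
  have htail : ∀ N : ℝ, ∃ K, 0 < K ∧ ∀ a, |a| ≤ N → ∀ m, 1 ≤ m → ∀ δ, 0 < δ →
      P {ω | δ < |hitQuotient X h b σ n a m ω - hitLimit h σ a|} ≤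
        ENNReal.ofReal (K / δ ^ 2 / M m) := by
    intro N
    obtain ⟨K, hK, hsq⟩ := hL.exists_integral_sq_sum_centredHit_le hC₀ hindep hmeas hh hσ hpos hA
      hgap' N
    refine ⟨K, hK, fun a ha m hm δ hδ => ?_⟩
    have hMm := hMpos m hm
    have hT : MemLp (fun ω => ∑ i ∈ Finset.Icc 1 m, centredHit X h b σ a (n i) ω) 2 P :=
      memLp_finsetSum _ fun i _ => memLp_centredHit hmeas a (n i)
    have := measure_lt_abs_le_of_integral_sq_le hT (hsq a ha m) (mul_pos hδ hMm)
    have e : K * M m / (δ * M m) ^ 2 = K / δ ^ 2 / M m := by field_simp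
    rw [← e]
    refine le_trans (le_of_eq ?_) this
    congr 1
    ext ω
    simp only [Set.mem_ofPred_eq]
    rw [hitQuotient_sub_eq hMm, abs_div, abs_of_pos hMm, lt_div_iff₀ hMm]
  constructor
  · intro a
    obtain ⟨K, hK, hKt⟩ := htail |a|
    have hconv := ae_tendsto_div_of_measure_le (P := P) (M := M) (l := hitLimit h σ a)
      (U := fun m ω => ∑ i ∈ Finset.Icc 1 m,
        (hitEvent X h b (a * σ) (n i)).indicator (fun _ => (1 : ℝ)) ω) ?_ ?_ ?_ ?_ ?_ ?_ ?_
    · filter_upwards [hconv] with ω hω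
      simpa only [hitQuotient, natCast_rpow_neg_half] using hω
    · intro ω
      refine monotone_nat_of_le_succ fun m => ?_
      rw [Finset.sum_Icc_succ_top (by omega)]
      exact le_add_of_nonneg_right (Set.indicator_nonneg (fun _ _ => zero_le_one) ω)
    · exact fun m ω => Finset.sum_nonneg fun i _ =>
        Set.indicator_nonneg (fun _ _ => zero_le_one) ω
    · refine monotone_nat_of_le_succ fun m => ?_
      simp only [hMdef]
      rw [Finset.sum_Icc_succ_top (by omega)]
      exact le_add_of_nonneg_right (by positivity)
    · simp [hMdef]
    · intro m
      simp only [hMdef]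
      rw [Finset.sum_Icc_succ_top (by omega)]
      have : 1 ≤ √(n (m + 1) : ℝ) :=
        Real.one_le_sqrt.2 (by exact_mod_cast hpos (m + 1) (by omega))
      have := (div_le_one (by linarith)).2 this
      linarith
    · refine tendsto_atTop_mono' atTop (f₁ := fun m : ℕ => c * √(Real.log m)) ?_ ?_
      · filter_upwards [eventually_ge_atTop 16] with m hm
        exact hlow m hm
      · exact (Real.tendsto_sqrt_atTop.comp
          (Real.tendsto_log_atTop.comp tendsto_natCast_atTop_atTop)).const_mul_atTop hc
    · intro ε hε
      refine ⟨K / ε ^ 2, by positivity, fun m hm => ?_⟩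
      have hm1 : 1 ≤ m := by
        by_contra hcon
        have : m = 0 := by omega
        rw [this] at hm
        simp [hMdef] at hm
      have := hKt a le_rfl m hm1 ε hε
      simpa only [hitQuotient, natCast_rpow_neg_half] using this
  · intro N hN
    obtain ⟨K, hK, hKt⟩ := htail N
    obtain ⟨D, hD, hDle⟩ := exists_log_log_mul_rpow_le hγ0
    have hlN := hitLimit_pos (a := N) hh hσ
    refine ⟨K * D / (hitLimit h σ N ^ 2 * c), by positivity, fun ε hε m hm => ?_⟩
    refine iSup₂_le fun a ha => ?_
    have haN : |a| ≤ N := abs_le.2 ha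
    have hla := hitLimit_pos (a := a) hh hσ
    have hle := hitLimit_le_hitLimit hh hσ haN
    have hMm := hMpos m (by omega)
    -- A relative deviation ε is an absolute deviation ε ℓ_a.
    have hset : {ω | ε < |hitQuotient X h b σ n a m ω / hitLimit h σ a - 1|} =
        {ω | ε * hitLimit h σ a < |hitQuotient X h b σ n a m ω - hitLimit h σ a|} := by
      ext ω
      simp only [Set.mem_ofPred_eq]
      rw [div_sub_one hla.ne', abs_div, abs_of_pos hla, lt_div_iff₀ hla]
    rw [hset]
    refine (hKt a haN m (by omega) _ (by positivity)).trans (ENNReal.ofReal_le_ofReal ?_)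
    have hm' : (16 : ℝ) ≤ m := by exact_mod_cast hm
    have hl2 := one_lt_log_log hm
    have hl3 : 0 < Real.log (Real.log (Real.log m)) := Real.log_pos hl2
    have hsl : 0 < √(Real.log m) := Real.sqrt_pos.2 (Real.log_pos (by linarith))
    have hE : ε ^ (-2 : ℝ) = 1 / ε ^ 2 := by
      rw [Real.rpow_neg hε.le, one_div]
      congr 1
      exact_mod_cast Real.rpow_natCast ε 2
    rw [hE, Real.rpow_neg hl3.le]
    set L := Real.log (Real.log m) with hLdef
    have hL0 : 0 < L := by linarith
    set G := Real.log L ^ γ with hG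
    have hG0 : 0 < G := Real.rpow_pos_of_pos hl3 _
    have hLG : L * G * c ≤ D * M m := by
      have h1 := hlow m hm
      have h2 := hDle m hm
      calc L * G * c ≤ D * √(Real.log m) * c := by gcongr
        _ = D * (c * √(Real.log m)) := by ring
        _ ≤ _ := by gcongr
    calc K / (ε * hitLimit h σ a) ^ 2 / M m ≤ K / (ε * hitLimit h σ N) ^ 2 / M m := by gcongr
      _ = K / (ε * hitLimit h σ N) ^ 2 * (1 / M m) := by ring
      _ ≤ K / (ε * hitLimit h σ N) ^ 2 * (D / (L * G * c)) := by
        refine mul_le_mul_of_nonneg_left ?_ (by positivity)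
        rw [div_le_div_iff₀ hMm (by positivity)]
        linarith
      _ = _ := by field_simp
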